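/- Let $n\ge 2$, let $|\cdot|$ denote Lebesgue measure on $\mathbb{R}^n$ (and the Euclidean norm of vectors), and let $\sigma_n$ be the volume of the unit ball. For a measurable set $A\subset\mathbb{R}^n$ let $A^*=B\big(0,(|A|/\sigma_n)^{1/n}\big)$ be the open centred ball with the same measure as $A$ (so $A^*=\mathbb{R}^n$ if $|A|=\infty$). For a measurable $f:\mathbb{R}^n\to\mathbb{R}$ define its spherical rearrangement by $$f^*_{Sp}(x)=\int_0^\infty \chi_{\{|f|>s\}^*}(x)\,ds\in[0,\infty],\qquad x\in\mathbb{R}^n;$$ equivalently $f^*_{Sp}(x)=f^*(\sigma_n|x|^n)$, with $f^*$ the classical decreasing rearrangement of $f$. A weight is a locally integrable function $v\ge 0$ on $\mathbb{R}^n$ such that, with $V(E)=\int_E v(x)\,dx$, one has $V(A^*)>0$ for every measurable $A$ with $|A|>0$. For $1\le p<\infty$ let $$\|f\|_{\Lambda^p_{Sp}(v)}=\Big(\int_{\mathbb{R}^n} f^*_{Sp}(x)^p\,v(x)\,dx\Big)^{1/p},$$ let $\Lambda^p_{Sp}(v)$ be the set of measurable $f$ for which this is finite, functions equal almost everywhere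 being identified, and let $$\bar v(s)=\int_{S^{n-1}} v\big((s/\sigma_n)^{1/n}\theta\big)\,d\theta,\qquad s>0,$$ where $d\theta$ is surface measure on the unit sphere $S^{n-1}$; $\bar v(s)$ is well defined for almost every $s>0$. **Theorem.** Let $v$ be a weight on $\mathbb{R}^n$, $n\ge2$, and $1\le p<\infty$. The following are equivalent: (a) $\|\cdot\|_{\Lambda^p_{Sp}(v)}$ is a norm on $\Lambda^p_{Sp}(v)$; (b) for all measurable $A,B\subset\mathbb{R}^n$, $V((A\cup B)^*)+V((A\cap B)^*)\le V(A^*)+V(B^*)$; (c) $\bar v$ is decreasing, that is, it coincides almost everywhere on $(0,\infty)$ with a nonincreasing function; (d) for all measurable functions $f$ on $\mathbb{R}^n$, $$\sup_{h}\int_{\mathbb{R}^n}|f(x)h(x)|\,dx=\int_{\mathbb{R}^n} f^*_{Sp}(x)\,\bar v(\sigma_n|x|^n)\,dx$$ as elements of $[0,\infty]$, where the supremum is over all measurable $h:\mathbb{R}^n\to\mathbb{R}$ with $h^*_{Sp}(x)=\bar v(\sigma_n|x|^n)$ for almost every $x$ (the supremum of the empty set being $0$). -/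

import Mathlib

open MeasureTheory Set

namespace SphericalLorentz

noncomputable section

/-- The volume `σ_n` of the unit ball of `ℝⁿ`. -/
def ballVol (n : ℕ) : ℝ := (volume (Metric.ball (0 : EuclideanSpace ℝ (Fin n)) 1)).toReal

/-- Spherical symmetrization of a set: the open ball centred at the origin of radius
`(|A| / σ_n) ^ (1 / n)`, which is the whole space when `|A| = ∞`. -/
def sphStar {n : ℕ} (A : Set (EuclideanSpace ℝ (Fin n))) : Set (EuclideanSpace ℝ (Fin n)) :=
  Metric.eball 0 ((volume A / ENNReal.ofReal (ballVol n)) ^ (1 / n : ℝ))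

/-- Spherical rearrangement of a function, by the layer-cake formula
`f*_Sp(x) = ∫₀^∞ χ_{{|f| > s}*}(x) ds`. -/
def rearr {n : ℕ} (f : EuclideanSpace ℝ (Fin n) → ℝ) (x : EuclideanSpace ℝ (Fin n)) : ENNReal :=
  ∫⁻ s in Ioi (0 : ℝ), (sphStar {y | s < |f y|}).indicator (fun _ => (1 : ENNReal)) x

/-- `V(E) = ∫_E v(x) dx`. -/
def mass {n : ℕ} (v : EuclideanSpace ℝ (Fin n) → ℝ) (E : Set (EuclideanSpace ℝ (Fin n))) :
    ENNReal :=
  ∫⁻ x in E, ENNReal.ofReal (v x)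

/-- Weights on `ℝⁿ`: nonnegative, locally integrable, and with the non-cancellation property that
`V(A*) > 0` whenever `|A| > 0`. -/
structure IsWeight {n : ℕ} (v : EuclideanSpace ℝ (Fin n) → ℝ) : Prop where
  nonneg : ∀ x, 0 ≤ v x
  locallyIntegrable : LocallyIntegrable v volume
  mass_star_pos : ∀ A : Set (EuclideanSpace ℝ (Fin n)), NullMeasurableSet A volume →
    0 < volume A → 0 < mass v (sphStar A)

/-- The functional `‖f‖ = (∫ (f*_Sp)^p v dx) ^ (1 / p)`, with values in `[0, ∞]`. -/
def lorentzNorm {n : ℕ} (p : ℝ) (v f : EuclideanSpace ℝ (Fin n) → ℝ) : ENNReal :=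
  (∫⁻ x, rearr f x ^ p * ENNReal.ofReal (v x)) ^ (1 / p)

/-- The Lorentz space `Λ^p_Sp(v)`: the (Lebesgue) measurable functions with finite functional. -/
def lorentzSpace {n : ℕ} (p : ℝ) (v : EuclideanSpace ℝ (Fin n) → ℝ) :
    Set (EuclideanSpace ℝ (Fin n) → ℝ) :=
  {f | AEMeasurable f volume ∧ lorentzNorm p v f < ⊤}

/-- The functional is a norm on `Λ^p_Sp(v)`, functions that agree almost everywhere being
identified. Finiteness of the right-hand side of `add_le` makes the space closed under addition. -/
structure IsNormOnLorentz {n : ℕ} (p : ℝ) (v : EuclideanSpace ℝ (Fin n) → ℝ) : Prop where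
  eq_zero_iff : ∀ f ∈ lorentzSpace p v, lorentzNorm p v f = 0 ↔ f =ᵐ[volume] 0
  smul : ∀ (c : ℝ), ∀ f ∈ lorentzSpace p v,
    lorentzNorm p v (c • f) = ENNReal.ofReal |c| * lorentzNorm p v f
  add_le : ∀ f ∈ lorentzSpace p v, ∀ g ∈ lorentzSpace p v,
    lorentzNorm p v (f + g) ≤ lorentzNorm p v f + lorentzNorm p v g

/-- The averaged weight `v̄(s) = ∫_{S^{n-1}} v((s / σ_n) ^ (1 / n) θ) dθ`, `s > 0`, where `dθ` is
surface measure on the unit sphere. -/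
def sphAvg {n : ℕ} (v : EuclideanSpace ℝ (Fin n) → ℝ) (s : ℝ) : ENNReal :=
  ∫⁻ θ : Metric.sphere (0 : EuclideanSpace ℝ (Fin n)) 1,
    ENNReal.ofReal (v ((s / ballVol n) ^ (1 / n : ℝ) • (θ : EuclideanSpace ℝ (Fin n))))
    ∂(volume : Measure (EuclideanSpace ℝ (Fin n))).toSphere

/-- `w` coincides almost everywhere on `(0, ∞)` with a decreasing (nonincreasing) function. -/
def IsDecreasingAE (w : ℝ → ENNReal) : Prop :=
  ∃ u : ℝ → ENNReal, AntitoneOn u (Ioi 0) ∧ w =ᵐ[volume.restrict (Ioi 0)] u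

end

end SphericalLorentz

namespace SphericalLorentz

/-! Everything reduces to the half-line. The map x ↦ σ_n|x|^n (`radialVol`) carries Lebesgue measure
to Lebesgue measure on (0, ∞), f*_Sp is the one-dimensional rearrangement f* (`decRearr`) composed
with it, and polar coordinates turn the integral of a radial function against v into (nσ_n)⁻¹ times
an integral against v̄ (`lintegral_radial_mul`). With J(t) = ∫_0^t v̄, this gives V(A*) =
J(|A|)/(nσ_n) when |A| < ∞, and (b) amounts to concavity of J.

(a) ⇒ (b): linearize the triangle inequality at C = A ∪ B. For f = χ_C + δχ_A and g = χ_C + δχ_B one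
has f + g = (2+δ)χ_C + δχ_{A∩B}. The two sides of the inequality agree at δ = 0, and their
first-order terms in δ give (b).

(b) ⇒ (c): testing on balls and spherical shells shows that the increments of J decrease, and J' =
v̄ almost everywhere by Lebesgue differentiation.

(c) ⇒ (a): the integrals ∫_0^t f* are subadditive in f (`setLIntegral_decRearr_add_le`). Hardy's
lemma and Hölder's inequality convert this into a weighted L^p bound by f* + g*
(`lintegral_rpow_le_of_antitone`), and Minkowski's inequality finishes.

(c) ⇔ (d): the upper bound is the Hardy-Littlewood inequality. For f with support of finite measure
it is attained by composing a decreasing version of v̄ with the measure-preserving `rank` of f, and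
monotone convergence removes the restriction on the support. Conversely, if v̄ is not decreasing no
h competes, so the supremum is 0, while the right side is positive for the indicator of a ball. -/

lemma volume_Ioi_inter_ofReal_lt (m : ENNReal) :
    volume {s : ℝ | 0 < s ∧ ENNReal.ofReal s < m} = m := by
  rcases eq_or_ne m ⊤ with rfl | hm
  · have : {s : ℝ | 0 < s ∧ ENNReal.ofReal s < ⊤} = Ioi 0 := by ext; simp
    rw [this, Real.volume_Ioi]
  · have : {s : ℝ | 0 < s ∧ ENNReal.ofReal s < m} = Ioo 0 m.toReal := by
      ext s
      simp only [mem_ofPred_eq, mem_Ioo, and_congr_right_iff]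
      intro hs
      exact ENNReal.ofReal_lt_iff_lt_toReal hs.le hm
    rw [this, Real.volume_Ioo, sub_zero, ENNReal.ofReal_toReal hm]

/-- A function into `[0, ∞)` whose sublevel sets `{T < t}` have measure `t` pushes the measure
forward to Lebesgue measure on the half-line. -/
lemma map_eq_restrict_Ioi {α : Type*} [MeasurableSpace α] {μ : Measure α} {T : α → ℝ}
    (hT : Measurable T) (h0 : ∀ x, 0 ≤ T x)
    (h : ∀ t : ℝ, 0 < t → μ {x | T x < t} = ENNReal.ofReal t) :
    μ.map T = volume.restrict (Ioi 0) := by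
  have h1 : ∀ t : ℝ, μ.map T (Iio t) = ENNReal.ofReal t := by
    intro t
    rw [Measure.map_apply hT measurableSet_Iio]
    rcases lt_or_ge 0 t with ht | ht
    · exact h t ht
    · have : T ⁻¹' Iio t = ∅ := by
        ext x; simpa using ht.trans (h0 x)
      rw [this, measure_empty, ENNReal.ofReal_of_nonpos ht]
  have h2 : ∀ t : ℝ, (volume.restrict (Ioi (0:ℝ))) (Iio t) = ENNReal.ofReal t := by
    intro t
    rw [Measure.restrict_apply measurableSet_Iio, inter_comm, Ioi_inter_Iio, Real.volume_Ioo,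
      sub_zero]
  have h3 : ∀ a b : ℝ, Ico a b = Iio b \ Iio a := by
    intro a b; ext x; simp
  refine Measure.ext_of_Ico' _ _ (fun a b _ => ?_) (fun a b hab => ?_)
  · rw [h3]
    exact ((measure_mono sdiff_subset).trans_lt ((h1 b).trans_lt ENNReal.ofReal_lt_top)).ne
  · rw [h3, measure_sdiff (Iio_subset_Iio hab.le) measurableSet_Iio.nullMeasurableSet
      (by rw [h1]; exact ENNReal.ofReal_ne_top),
      measure_sdiff (Iio_subset_Iio hab.le) measurableSet_Iio.nullMeasurableSet
      (by rw [h2]; exact ENNReal.ofReal_ne_top), h1, h1, h2, h2]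

/-! ### Distribution functions, decreasing rearrangements, Hardy-Littlewood inequality -/

section Layercake

variable {α : Type*} [MeasurableSpace α] {μ : Measure α}

/-- Layer-cake formula for `[0, ∞]`-valued functions against a density. -/
lemma lintegral_mul_eq_layercake [SFinite μ] {F G : α → ENNReal} (hF : Measurable F) (hG : Measurable G) :
    ∫⁻ x, F x * G x ∂μ = ∫⁻ s in Ioi (0:ℝ), ∫⁻ x in {x | ENNReal.ofReal s < F x}, G x ∂μ := by
  have hm : MeasurableSet {q : α × ℝ | ENNReal.ofReal q.2 < F q.1} :=
    measurableSet_lt (by fun_prop) (by fun_prop)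
  have h1 : ∀ x, F x * G x = ∫⁻ s in Ioi (0:ℝ),
      {q : α × ℝ | ENNReal.ofReal q.2 < F q.1}.indicator (fun q => G q.1) (x, s) := by
    intro x
    have : (fun s : ℝ => {q : α × ℝ | ENNReal.ofReal q.2 < F q.1}.indicator (fun q => G q.1) (x, s))
        = {s : ℝ | ENNReal.ofReal s < F x}.indicator (fun _ => G x) := by
      ext s; simp [indicator]
    have hs : MeasurableSet {s : ℝ | ENNReal.ofReal s < F x} :=
      measurableSet_lt (by fun_prop) (by fun_prop)
    rw [this, lintegral_indicator_const hs, Measure.restrict_apply hs, mul_comm]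
    congr 1
    refine (volume_Ioi_inter_ofReal_lt (F x)).symm.trans ?_
    congr 1; ext s; simp [and_comm]
  simp_rw [h1]
  rw [lintegral_lintegral_swap]
  · refine lintegral_congr fun s => ?_
    rw [← lintegral_indicator (measurableSet_lt (by fun_prop) hF)]
    rfl
  · exact ((hG.comp measurable_fst).indicator hm).aemeasurable

/-- The distribution function of `|f|`. -/
noncomputable def distrib (μ : Measure α) (f : α → ℝ) (s : ℝ) : ENNReal := μ {y | s < |f y|}

/-- The decreasing rearrangement of `f` on the half-line. -/
noncomputable def decRearr (μ : Measure α) (f : α → ℝ) (r : ℝ) : ENNReal :=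
  volume {s : ℝ | 0 < s ∧ ENNReal.ofReal r < distrib μ f s}

lemma distrib_antitone (f : α → ℝ) : Antitone (distrib μ f) :=
  fun _ _ hst => measure_mono fun _ hy => hst.trans_lt hy

lemma distrib_congr {f g : α → ℝ} (h : ∀ᵐ x ∂μ, |f x| = |g x|) : distrib μ f = distrib μ g := by
  ext s
  refine measure_congr ?_
  filter_upwards [h] with x hx
  change (s < |f x|) = (s < |g x|)
  rw [hx]

lemma decRearr_congr {f g : α → ℝ} (h : ∀ᵐ x ∂μ, |f x| = |g x|) : decRearr μ f = decRearr μ g := by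
  unfold decRearr; rw [distrib_congr h]

lemma decRearr_antitone (f : α → ℝ) : Antitone (decRearr μ f) :=
  fun _ _ hrs => measure_mono fun _ ht => ⟨ht.1, (ENNReal.ofReal_le_ofReal hrs).trans_lt ht.2⟩

lemma decRearr_measurable (f : α → ℝ) : Measurable (decRearr μ f) :=
  (decRearr_antitone f).measurable

lemma decRearr_smul (c : ℝ) (f : α → ℝ) (r : ℝ) :
    decRearr μ (c • f) r = ENNReal.ofReal |c| * decRearr μ f r := by
  rcases eq_or_ne c 0 with rfl | hc
  · have : {s : ℝ | 0 < s ∧ ENNReal.ofReal r < distrib μ ((0:ℝ) • f) s} = ∅ := by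
      ext s
      simp only [mem_ofPred_eq, mem_empty_iff_false, iff_false, not_and, not_lt]
      intro hs
      simp [distrib, not_lt.2 hs.le]
    simp only [decRearr]
    rw [this]; simp
  · have hc' : 0 < |c| := abs_pos.2 hc
    have h1 : {s : ℝ | 0 < s ∧ ENNReal.ofReal r < distrib μ (c • f) s} =
        (|c|⁻¹ * ·) ⁻¹' {s : ℝ | 0 < s ∧ ENNReal.ofReal r < distrib μ f s} := by
      ext s
      have h2 : distrib μ (c • f) s = distrib μ f (|c|⁻¹ * s) := by
        unfold distrib
        congr 1; ext y
        simp only [Pi.smul_apply, smul_eq_mul, abs_mul, mem_ofPred_eq]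
        rw [inv_mul_lt_iff₀ hc']
      simp only [mem_ofPred_eq, mem_preimage, h2]
      rw [mul_pos_iff_of_pos_left (inv_pos.2 hc')]
    simp only [decRearr]
    rw [h1, Real.volume_preimage_mul_left (inv_ne_zero hc'.ne')]
    simp

/-- Tonelli's theorem for integrals against a decreasing rearrangement. -/
lemma lintegral_decRearr_mul (f : α → ℝ) {ν : Measure ℝ} [SFinite ν] {G : ℝ → ENNReal}
    (hG : Measurable G) :
    ∫⁻ r, decRearr μ f r * G r ∂ν =
      ∫⁻ s in Ioi (0:ℝ), ∫⁻ r in {r | ENNReal.ofReal r < distrib μ f s}, G r ∂ν := by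
  have hd := (distrib_antitone (μ := μ) f).measurable
  have hm : MeasurableSet {q : ℝ × ℝ | ENNReal.ofReal q.1 < distrib μ f q.2} :=
    measurableSet_lt (by fun_prop) (by fun_prop)
  have h1 : ∀ r, decRearr μ f r * G r = ∫⁻ s in Ioi (0:ℝ),
      {q : ℝ × ℝ | ENNReal.ofReal q.1 < distrib μ f q.2}.indicator (fun q => G q.1) (r, s) := by
    intro r
    have : (fun s : ℝ => {q : ℝ × ℝ | ENNReal.ofReal q.1 < distrib μ f q.2}.indicator
        (fun q => G q.1) (r, s)) = {s : ℝ | ENNReal.ofReal r < distrib μ f s}.indicator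
          (fun _ => G r) := by
      ext s; simp [indicator]
    have hs : MeasurableSet {s : ℝ | ENNReal.ofReal r < distrib μ f s} :=
      measurableSet_lt (by fun_prop) (by fun_prop)
    rw [this, lintegral_indicator_const hs, Measure.restrict_apply hs, mul_comm]
    congr 1
    simp only [decRearr]
    congr 1; ext s; simp [and_comm]
  simp_rw [h1]
  rw [lintegral_lintegral_swap]
  · refine lintegral_congr fun s => ?_
    rw [← lintegral_indicator (measurableSet_lt (by fun_prop) (by fun_prop))]
    rfl
  · exact ((hG.comp measurable_fst).indicator hm).aemeasurable

/-- The Hardy-Littlewood inequality. -/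
lemma lintegral_abs_mul_le [SFinite μ] {f h : α → ℝ} (hf : AEMeasurable f μ) (hh : AEMeasurable h μ) :
    ∫⁻ x, ENNReal.ofReal |f x * h x| ∂μ ≤
      ∫⁻ r in Ioi (0:ℝ), decRearr μ f r * decRearr μ h r := by
  wlog hm : Measurable f ∧ Measurable h generalizing f h
  · have hf' := hf.ae_eq_mk
    have hh' := hh.ae_eq_mk
    have := this hf.measurable_mk.aemeasurable hh.measurable_mk.aemeasurable
      ⟨hf.measurable_mk, hh.measurable_mk⟩
    rw [decRearr_congr (f := f) (g := hf.mk) (hf'.mono fun x hx => by rw [hx]),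
      decRearr_congr (f := h) (g := hh.mk) (hh'.mono fun x hx => by rw [hx])]
    refine le_of_eq_of_le (lintegral_congr_ae ?_) this
    filter_upwards [hf', hh'] with x h1 h2
    rw [h1, h2]
  obtain ⟨hf, hh⟩ := hm
  have ef : ∀ s : ℝ, 0 < s → ∀ g : α → ℝ,
      {x | ENNReal.ofReal s < ENNReal.ofReal |g x|} = {x | s < |g x|} := by
    intro s hs g; ext x
    exact ENNReal.ofReal_lt_ofReal_iff_of_nonneg hs.le
  simp_rw [abs_mul, ENNReal.ofReal_mul (abs_nonneg _)]
  rw [lintegral_mul_eq_layercake (by fun_prop) (by fun_prop),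
    lintegral_decRearr_mul f (decRearr_measurable h)]
  refine setLIntegral_mono' measurableSet_Ioi fun s hs => ?_
  rw [ef s hs]
  have := lintegral_mul_eq_layercake (μ := μ.restrict {x | s < |f x|})
    (F := fun x => ENNReal.ofReal |h x|) (G := fun _ => 1) (by fun_prop) (by fun_prop)
  simp only [mul_one] at this
  rw [this]
  have h2 := lintegral_decRearr_mul (μ := μ) h
    (ν := (volume.restrict (Ioi 0)).restrict {r | ENNReal.ofReal r < distrib μ f s})
    (G := fun _ => 1) measurable_const
  simp only [mul_one] at h2
  rw [h2]
  refine setLIntegral_mono' measurableSet_Ioi fun t ht => ?_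
  rw [ef t ht, setLIntegral_one, setLIntegral_one,
    Measure.restrict_apply (measurableSet_lt (by fun_prop) (by fun_prop)),
    Measure.restrict_apply (measurableSet_lt (by fun_prop) (by fun_prop)),
    Measure.restrict_apply ((measurableSet_lt (by fun_prop) (by fun_prop)).inter
      (measurableSet_lt (by fun_prop) (by fun_prop)))]
  have h3 : {r | ENNReal.ofReal r < distrib μ h t} ∩ {r | ENNReal.ofReal r < distrib μ f s} ∩ Ioi 0
      = {r | 0 < r ∧ ENNReal.ofReal r < min (distrib μ h t) (distrib μ f s)} := by
    ext r; simp [and_comm]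
  rw [h3, volume_Ioi_inter_ofReal_lt]
  -- After slicing both functions, the inequality is just |E ∩ F| ≤ min(|E|, |F|) for superlevel
  -- sets E and F, with equality for the nested ones of the rearrangements.
  exact le_min (measure_mono inter_subset_left) (measure_mono inter_subset_right)

end Layercake

/-! ### Subadditivity of ∫_0^t f*, Hardy's lemma, weighted L^p domination -/

section Hardy

variable {α : Type*} [MeasurableSpace α] {μ : Measure α}

lemma setLIntegral_decRearr (f : α → ℝ) (t : ℝ) :
    ∫⁻ r in Ioo 0 t, decRearr μ f r =
      ∫⁻ s in Ioi (0:ℝ), min (ENNReal.ofReal t) (distrib μ f s) := by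
  have h2 := lintegral_decRearr_mul (μ := μ) f (ν := volume.restrict (Ioo 0 t))
    (G := fun _ => 1) measurable_const
  simp only [mul_one] at h2
  rw [h2]
  refine setLIntegral_congr_fun measurableSet_Ioi fun s _ => ?_
  rw [setLIntegral_one, Measure.restrict_apply (measurableSet_lt (by fun_prop) (by fun_prop))]
  refine Eq.trans ?_ (volume_Ioi_inter_ofReal_lt _)
  congr 1; ext r
  simp only [mem_inter_iff, mem_ofPred_eq, mem_Ioo, lt_min_iff]
  constructor
  · rintro ⟨h, h0, h1⟩
    exact ⟨h0, (ENNReal.ofReal_lt_ofReal_iff_of_nonneg h0.le).2 h1, h⟩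
  · rintro ⟨h0, h1, h⟩
    exact ⟨h, h0, (ENNReal.ofReal_lt_ofReal_iff_of_nonneg h0.le).1 h1⟩

lemma setLIntegral_Ioi_distrib {f : α → ℝ} (hf : AEMeasurable f μ) (l : ℝ) :
    ∫⁻ s in Ioi l, distrib μ f s = ∫⁻ x, ENNReal.ofReal (|f x| - l) ∂μ := by
  have h1 := lintegral_eq_lintegral_meas_lt μ (f := fun x => max (|f x| - l) 0)
    (Filter.Eventually.of_forall fun x => le_max_right _ _) (by fun_prop)
  have h2 : ∀ x, ENNReal.ofReal (max (|f x| - l) 0) = ENNReal.ofReal (|f x| - l) := by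
    intro x; rw [ENNReal.ofReal_max]; simp
  simp_rw [h2] at h1
  rw [h1]
  have h3 : (Ioi l) = (fun s => s - l) ⁻¹' (Ioi 0) := by ext; simp
  have h4 : ∀ s ∈ Ioi l, distrib μ f s = μ {a | (s - l) < max (|f a| - l) 0} := by
    intro s hs
    unfold distrib
    congr 1; ext a
    have : 0 < s - l := sub_pos.2 hs
    simp [not_lt.2 this.le]
  rw [setLIntegral_congr_fun measurableSet_Ioi h4, h3]
  have hanti : Antitone fun t : ℝ => μ {a | t < max (|f a| - l) 0} :=
    fun s t hst => measure_mono fun a ha => hst.trans_lt ha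
  exact (measurePreserving_sub_right (volume : Measure ℝ) l).setLIntegral_comp_preimage
    measurableSet_Ioi hanti.measurable

/-- Cut the integral of min(t, distribution) at height l, bounding the integrand by t below l and by
the distribution function above it. With the next lemma this yields ∫_0^t f* = min over l ≥ 0 of tl
+ ∫(|f| - l)₊, the K-functional between L¹ and L^∞, from which subadditivity is visible. -/
lemma setLIntegral_decRearr_le {f : α → ℝ} (hf : AEMeasurable f μ) (t : ℝ) {l : ℝ} (hl : 0 ≤ l) :
    ∫⁻ r in Ioo 0 t, decRearr μ f r ≤
      ENNReal.ofReal t * ENNReal.ofReal l + ∫⁻ x, ENNReal.ofReal (|f x| - l) ∂μ := by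
  rw [setLIntegral_decRearr, ← setLIntegral_Ioi_distrib hf, ← Ioc_union_Ioi_eq_Ioi hl,
    lintegral_union measurableSet_Ioi (Ioc_disjoint_Ioi le_rfl)]
  refine add_le_add ?_ (lintegral_mono fun s => min_le_right _ _)
  calc _ ≤ ∫⁻ s in Ioc 0 l, ENNReal.ofReal t := lintegral_mono fun s => min_le_left _ _
    _ = _ := by simp

/-- The optimal level is the infimum of the heights at which the distribution function is at most t:
below it the minimum of the two is t, above it the minimum is the distribution function, so nothing
is lost in the cut. -/
lemma exists_le_setLIntegral_decRearr {f : α → ℝ} (hf : AEMeasurable f μ) {t : ℝ} (ht : 0 < t)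
    (hfin : ∫⁻ r in Ioo 0 t, decRearr μ f r ≠ ⊤) :
    ∃ l : ℝ, 0 ≤ l ∧ ENNReal.ofReal t * ENNReal.ofReal l + ∫⁻ x, ENNReal.ofReal (|f x| - l) ∂μ ≤
      ∫⁻ r in Ioo 0 t, decRearr μ f r := by
  set S : Set ℝ := {s | 0 < s ∧ distrib μ f s ≤ ENNReal.ofReal t} with hS
  -- Otherwise the minimum equals t at every height and the integral is infinite.
  have hSne : S.Nonempty := by
    by_contra hne
    rw [not_nonempty_iff_eq_empty] at hne
    apply hfin
    rw [setLIntegral_decRearr, eq_top_iff]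
    calc ⊤ = ∫⁻ s in Ioi (0:ℝ), ENNReal.ofReal t := by simp [ht]
      _ ≤ _ := by
        refine setLIntegral_mono' measurableSet_Ioi fun s hs => le_min le_rfl ?_
        by_contra hlt
        exact (hne ▸ notMem_empty s) (show s ∈ S from ⟨hs, (not_le.1 hlt).le⟩)
  have hbd : BddBelow S := ⟨0, fun s hs => hs.1.le⟩
  have hl : 0 ≤ sInf S := le_csInf hSne fun s hs => hs.1.le
  refine ⟨sInf S, hl, ?_⟩
  rw [setLIntegral_decRearr, ← setLIntegral_Ioi_distrib hf]
  rw [← Ioc_union_Ioi_eq_Ioi hl]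
  rw [lintegral_union measurableSet_Ioi (Ioc_disjoint_Ioi le_rfl)]
  refine add_le_add ?_ ?_
  · calc _ = ∫⁻ s in Ioo 0 (sInf S), ENNReal.ofReal t := by simp
      _ ≤ ∫⁻ s in Ioo 0 (sInf S), min (ENNReal.ofReal t) (distrib μ f s) := by
        refine setLIntegral_mono' measurableSet_Ioo fun s hs => le_min le_rfl ?_
        by_contra hlt
        exact absurd (csInf_le hbd (show s ∈ S from ⟨hs.1, (not_le.1 hlt).le⟩)) (not_le.2 hs.2)
      _ ≤ _ := lintegral_mono_set Ioo_subset_Ioc_self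
  · refine setLIntegral_mono' measurableSet_Ioi fun s hs => le_min ?_ le_rfl
    obtain ⟨s', hs', hlt⟩ := exists_lt_of_csInf_lt hSne hs
    exact (distrib_antitone f hlt.le).trans hs'.2

/-- Subadditivity of the integrals of decreasing rearrangements over initial intervals. -/
lemma setLIntegral_decRearr_add_le {f g : α → ℝ} (hf : AEMeasurable f μ) (hg : AEMeasurable g μ)
    {t : ℝ} (ht : 0 < t) :
    ∫⁻ r in Ioo 0 t, decRearr μ (f + g) r ≤
      ∫⁻ r in Ioo 0 t, (decRearr μ f r + decRearr μ g r) := by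
  rw [lintegral_add_left (decRearr_measurable f)]
  by_cases hF : ∫⁻ r in Ioo 0 t, decRearr μ f r = ⊤
  · simp [hF]
  by_cases hG : ∫⁻ r in Ioo 0 t, decRearr μ g r = ⊤
  · simp [hG]
  obtain ⟨l, hl, h1⟩ := exists_le_setLIntegral_decRearr hf ht hF
  obtain ⟨m, hm, h2⟩ := exists_le_setLIntegral_decRearr hg ht hG
  -- The sum of the two optimal levels serves for f + g, because (|f+g| - (l+m))₊ ≤ (|f| - l)₊ +
  -- (|g| - m)₊.
  refine (setLIntegral_decRearr_le (hf.add hg) t (add_nonneg hl hm)).trans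
    (le_trans ?_ (add_le_add h1 h2))
  rw [ENNReal.ofReal_add hl hm, mul_add, add_add_add_comm]
  gcongr
  rw [← lintegral_add_left' (by fun_prop)]
  refine lintegral_mono fun x => ?_
  refine le_trans (ENNReal.ofReal_le_ofReal ?_) ENNReal.ofReal_add_le
  have := abs_add_le (f x) (g x)
  simp only [Pi.add_apply]
  linarith

/-- Hardy's lemma. -/
lemma lintegral_mul_le_of_antitone {F G W : ℝ → ENNReal} (hF : Measurable F) (hG : Measurable G)
    (hW : Antitone W) (h : ∀ t : ℝ, 0 < t → ∫⁻ r in Ioo 0 t, F r ≤ ∫⁻ r in Ioo 0 t, G r) :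
    ∫⁻ r in Ioi (0:ℝ), F r * W r ≤ ∫⁻ r in Ioi (0:ℝ), G r * W r := by
  simp_rw [mul_comm _ (W _)]
  rw [lintegral_mul_eq_layercake hW.measurable hF, lintegral_mul_eq_layercake hW.measurable hG]
  refine setLIntegral_mono' measurableSet_Ioi fun s _ => ?_
  rw [Measure.restrict_restrict (measurableSet_lt (by fun_prop) hW.measurable)]
  -- A superlevel set of a decreasing W is an initial interval up to its endpoint. The hypothesis
  -- applies directly if it is bounded, and through an exhaustion if it is the whole half-line.
  set A := {x | ENNReal.ofReal s < W x} ∩ Ioi 0 with hA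
  have hdown : ∀ x ∈ A, ∀ y, 0 < y → y ≤ x → y ∈ A :=
    fun x hx y hy hyx => ⟨lt_of_lt_of_le hx.1 (hW hyx), hy⟩
  rcases A.eq_empty_or_nonempty with hE | hne
  · simp [hE]
  by_cases hb : BddAbove A
  · have hpos : 0 < sSup A := by
      obtain ⟨x, hx⟩ := hne
      exact lt_of_lt_of_le hx.2 (le_csSup hb hx)
    have hae : A =ᵐ[volume] Ioo 0 (sSup A) := by
      refine Filter.EventuallyLE.antisymm ?_ ?_
      · refine Filter.EventuallyLE.trans_eq (LE.le.eventuallyLE ?_) Ioo_ae_eq_Ioc.symm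
        exact fun x hx => ⟨hx.2, le_csSup hb hx⟩
      · refine LE.le.eventuallyLE ?_
        intro x hx
        obtain ⟨y, hy, hxy⟩ := exists_lt_of_lt_csSup hne hx.2
        exact hdown y hy x hx.1 hxy.le
    rw [setLIntegral_congr hae, setLIntegral_congr hae]
    exact h _ hpos
  · have hAu : A = Ioi 0 := by
      refine subset_antisymm inter_subset_right fun x hx => ?_
      rw [not_bddAbove_iff] at hb
      obtain ⟨y, hy, hxy⟩ := hb x
      exact hdown y hy x hx hxy.le
    have hun : Ioi (0:ℝ) = ⋃ k : ℕ, Ioo (0:ℝ) (k + 1) := by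
      ext x
      simp only [mem_Ioi, mem_iUnion, mem_Ioo, exists_and_left, iff_self_and]
      intro _
      obtain ⟨k, hk⟩ := exists_nat_gt x
      exact ⟨k, hk.trans (lt_add_one _)⟩
    have hdir : Directed (· ⊆ ·) fun k : ℕ => Ioo (0:ℝ) (k + 1) :=
      Monotone.directed_le fun i j hij => Ioo_subset_Ioo_right (by gcongr)
    rw [hAu, hun, setLIntegral_iUnion_of_directed _ hdir, setLIntegral_iUnion_of_directed _ hdir]
    exact iSup_mono fun k => h _ (by positivity)

/-- Hardy-Littlewood-Polya domination implies domination of weighted `L^p` norms with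
decreasing weight. -/
lemma lintegral_rpow_le_of_antitone {K G u : ℝ → ENNReal} {p : ℝ} (hp : 1 ≤ p)
    (hK : Antitone K) (hG : Measurable G) (hu : Antitone u)
    (hfin : ∀ t : ℝ, 0 < t → ∫⁻ r in Ioo 0 t, u r < ⊤)
    (h : ∀ t : ℝ, 0 < t → ∫⁻ r in Ioo 0 t, K r ≤ ∫⁻ r in Ioo 0 t, G r) :
    (∫⁻ r in Ioi (0:ℝ), K r ^ p * u r) ^ (1 / p) ≤
      (∫⁻ r in Ioi (0:ℝ), G r ^ p * u r) ^ (1 / p) := by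
  have hp0 : 0 < p := by linarith
  have hKm := hK.measurable
  have hum := hu.measurable
  -- truncations of `K`
  set X : ℕ → ℝ → ENNReal := fun N r => if r < N then min (K r) N else 0 with hX
  have hXanti : ∀ N, Antitone (X N) := by
    intro N r s hrs
    simp only [hX]
    split_ifs with h1 h2
    · exact min_le_min_right _ (hK hrs)
    · exact absurd (hrs.trans_lt h1) h2
    · exact zero_le
    · exact le_rfl
  have hXmono : Monotone X := by
    intro M N hMN r
    have hMN' : (M : ℝ) ≤ N := by exact_mod_cast hMN
    simp only [hX]
    split_ifs with h1 h2
    · exact min_le_min_left _ (by exact_mod_cast hMN)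
    · exact absurd (h1.trans_le hMN') h2
    · exact zero_le
    · exact le_rfl
  have hXsup : ∀ r, ⨆ N, X N r = K r := by
    intro r
    refine le_antisymm (iSup_le fun N => ?_) ?_
    · simp only [hX]; split_ifs
      · exact min_le_left _ _
      · exact zero_le
    · refine le_of_forall_lt fun a ha => ?_
      obtain ⟨k, hk⟩ := exists_nat_gt r
      obtain ⟨m, hm⟩ := ENNReal.exists_nat_gt ha.ne_top
      refine lt_of_lt_of_le ?_ (le_iSup _ (max k m))
      have : r < ((max k m : ℕ) : ℝ) := hk.trans_le (by exact_mod_cast le_max_left _ _)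
      simp only [hX, if_pos this]
      exact lt_min ha (hm.trans_le (by exact_mod_cast le_max_right _ _))
  have hXK : ∀ N r, X N r ≤ K r := fun N r => hXsup r ▸ le_iSup (fun N => X N r) N
  have hKsup : ∫⁻ r in Ioi (0:ℝ), K r ^ p * u r = ⨆ N, ∫⁻ r in Ioi (0:ℝ), X N r ^ p * u r := by
    rw [← lintegral_iSup]
    · refine lintegral_congr fun r => ?_
      rw [← ENNReal.iSup_mul, ← hXsup r]
      congr 1
      exact (ENNReal.monotone_rpow_of_nonneg hp0.le).map_iSup_of_continuousAt
        (ENNReal.continuous_rpow_const.continuousAt) (by simp [hp0])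
    · exact fun N => ((hXanti N).measurable.pow_const p).mul hum
    · intro M N hMN r
      exact mul_le_mul_left (ENNReal.rpow_le_rpow (hXmono hMN r) hp0.le) _
  suffices hN : ∀ N, (∫⁻ r in Ioi (0:ℝ), X N r ^ p * u r) ≤ ∫⁻ r in Ioi (0:ℝ), G r ^ p * u r by
    rw [hKsup]
    exact ENNReal.rpow_le_rpow (iSup_le hN) (by positivity)
  intro N
  -- The truncation exists for the sake of this finiteness, which allows division in Hölder's
  -- inequality below.
  have hXfin : ∫⁻ r in Ioi (0:ℝ), X N r ^ p * u r < ⊤ := by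
    calc ∫⁻ r in Ioi (0:ℝ), X N r ^ p * u r
        ≤ ∫⁻ r in Ioi (0:ℝ), (Ioo 0 (N + 1 : ℝ)).indicator (fun r => (N : ENNReal) ^ p * u r) r := by
          refine setLIntegral_mono' measurableSet_Ioi fun r hr => ?_
          simp only [hX]
          split_ifs with h1
          · rw [indicator_of_mem (show r ∈ Ioo 0 (N + 1 : ℝ) from ⟨hr, by linarith⟩)]
            gcongr
            exact min_le_right _ _
          · simp [hp0]
      _ ≤ ∫⁻ r, (Ioo 0 (N + 1 : ℝ)).indicator (fun r => (N : ENNReal) ^ p * u r) r :=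
          lintegral_mono' Measure.restrict_le_self le_rfl
      _ = (N : ENNReal) ^ p * ∫⁻ r in Ioo 0 (N + 1 : ℝ), u r := by
          rw [lintegral_indicator measurableSet_Ioo, lintegral_const_mul _ hum]
      _ < ⊤ := ENNReal.mul_lt_top (ENNReal.rpow_lt_top_of_nonneg hp0.le (by simp))
          (hfin _ (by positivity))
  -- Since X ≤ K, ∫ X^p u ≤ ∫ K · (X^(p-1) u). The factor X^(p-1) u is decreasing, so Hardy's lemma
  -- replaces K by G, and Hölder with respect to u dr lets a power of ∫ X^p u be cancelled.
  have hWanti : Antitone fun r => X N r ^ (p - 1) * u r := fun r s hrs =>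
    mul_le_mul' (ENNReal.rpow_le_rpow (hXanti N hrs) (by linarith)) (hu hrs)
  have hle : ∫⁻ r in Ioi (0:ℝ), X N r ^ p * u r ≤
      ∫⁻ r in Ioi (0:ℝ), G r * (X N r ^ (p - 1) * u r) := by
    refine le_trans (lintegral_mono fun r => ?_)
      (lintegral_mul_le_of_antitone hKm hG hWanti h)
    simp only
    rw [← mul_assoc]
    refine mul_le_mul_left ?_ _
    calc X N r ^ p = X N r ^ (1 + (p - 1)) := by ring_nf
      _ = X N r ^ (1:ℝ) * X N r ^ (p - 1) :=
          ENNReal.rpow_add_of_nonneg _ _ zero_le_one (by linarith)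
      _ ≤ _ := by rw [ENNReal.rpow_one]; exact mul_le_mul_left (hXK N r) _
  rcases hp.eq_or_lt with rfl | hp1
  · simpa using hle
  · have hpq := Real.HolderConjugate.conjExponent hp1
    set ν : Measure ℝ := (volume.restrict (Ioi 0)).withDensity u with hν
    have hwd : ∀ F : ℝ → ENNReal, Measurable F →
        ∫⁻ r in Ioi (0:ℝ), F r * u r = ∫⁻ r, F r ∂ν := by
      intro F hF
      rw [hν, lintegral_withDensity_eq_lintegral_mul _ hum hF]
      simp [mul_comm]
    have hXm := (hXanti N).measurable
    simp_rw [← mul_assoc] at hle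
    rw [hwd _ (by fun_prop), hwd _ (by fun_prop)] at hle
    rw [hwd _ (by fun_prop)] at hXfin
    rw [hwd _ (by fun_prop), hwd _ (by fun_prop)]
    have hH := hle.trans (ENNReal.lintegral_mul_rpow_le_lintegral_rpow_mul_lintegral_rpow hpq
      (μ := ν) hG.aemeasurable hXm.aemeasurable)
    set x := ∫⁻ r, X N r ^ p ∂ν
    set g := ∫⁻ r, G r ^ p ∂ν
    rcases eq_or_ne x 0 with hx0 | hx0
    · rw [hx0]; exact zero_le
    have hx : x ^ (1 / p) * x ^ (1 / p.conjExponent) = x := by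
      rw [← ENNReal.rpow_add _ _ hx0 hXfin.ne, one_div, one_div, hpq.inv_add_inv_eq_one,
        ENNReal.rpow_one]
    have hq0 : x ^ (1 / p.conjExponent) ≠ 0 := by simp [hx0, hXfin.ne]
    have hqt : x ^ (1 / p.conjExponent) ≠ ⊤ :=
      ENNReal.rpow_ne_top_of_nonneg (by have := hpq.symm.pos; positivity) hXfin.ne
    nth_rewrite 1 [← hx] at hH
    rw [ENNReal.mul_le_mul_iff_left hq0 hqt] at hH
    exact (ENNReal.rpow_le_rpow_iff (by positivity)).1 hH

end Hardy

/-! ### Reduction to the half-line by polar coordinates -/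

section Polar

variable {n : ℕ}

/-- The volume of the centred ball with `x` on its boundary. -/
noncomputable def radialVol (x : EuclideanSpace ℝ (Fin n)) : ℝ := ballVol n * ‖x‖ ^ n

lemma ballVol_pos (n : ℕ) : 0 < ballVol n :=
  ENNReal.toReal_pos (Metric.measure_ball_pos _ _ one_pos).ne' measure_ball_lt_top.ne

lemma ofReal_ballVol (n : ℕ) :
    ENNReal.ofReal (ballVol n) = volume (Metric.ball (0 : EuclideanSpace ℝ (Fin n)) 1) :=
  ENNReal.ofReal_toReal measure_ball_lt_top.ne

lemma radialVol_nonneg (x : EuclideanSpace ℝ (Fin n)) : 0 ≤ radialVol x :=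
  mul_nonneg (ballVol_pos n).le (by positivity)

lemma measurable_radialVol : Measurable (radialVol (n := n)) := by
  unfold radialVol; fun_prop

lemma rpow_radialVol_div (hn : n ≠ 0) {r : ℝ} (hr : 0 ≤ r) :
    (ballVol n * r ^ n / ballVol n) ^ (1 / n : ℝ) = r := by
  rw [mul_div_cancel_left₀ _ (ballVol_pos n).ne', one_div, Real.pow_rpow_inv_natCast hr hn]

lemma map_radialVol (hn : n ≠ 0) :
    (volume : Measure (EuclideanSpace ℝ (Fin n))).map radialVol = volume.restrict (Ioi 0) := by
  have : Nonempty (Fin n) := ⟨⟨0, Nat.pos_of_ne_zero hn⟩⟩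
  refine map_eq_restrict_Ioi measurable_radialVol radialVol_nonneg fun t ht => ?_
  have hσ := ballVol_pos n
  have h1 : {x : EuclideanSpace ℝ (Fin n) | radialVol x < t} =
      Metric.ball 0 ((t / ballVol n) ^ (1 / n : ℝ)) := by
    ext x
    simp only [radialVol, mem_ofPred_eq, mem_ball_zero_iff]
    rw [one_div, Real.lt_rpow_inv_iff_of_pos (norm_nonneg _) (by positivity) (by positivity),
      Real.rpow_natCast, lt_div_iff₀ hσ, mul_comm]
  rw [h1, Measure.addHaar_ball _ _ (by positivity), ← ofReal_ballVol,
    ← ENNReal.ofReal_mul (by positivity), finrank_euclideanSpace, Fintype.card_fin, one_div,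
    Real.rpow_inv_natCast_pow (by positivity) hn, div_mul_cancel₀ _ hσ.ne']

lemma lintegral_comp_radialVol (hn : n ≠ 0) {F : ℝ → ENNReal}
    (hF : AEMeasurable F (volume.restrict (Ioi 0))) :
    ∫⁻ x : EuclideanSpace ℝ (Fin n), F (radialVol x) = ∫⁻ s in Ioi (0:ℝ), F s := by
  rw [← map_radialVol hn] at hF ⊢
  rw [lintegral_map' hF measurable_radialVol.aemeasurable]

lemma ae_comp_radialVol (hn : n ≠ 0) {P : ℝ → Prop} (h : ∀ᵐ s ∂volume.restrict (Ioi 0), P s) :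
    ∀ᵐ x : EuclideanSpace ℝ (Fin n), P (radialVol x) := by
  rw [← map_radialVol hn] at h
  exact ae_of_ae_map measurable_radialVol.aemeasurable h

lemma mem_sphStar_iff (hn : n ≠ 0) (A : Set (EuclideanSpace ℝ (Fin n)))
    (x : EuclideanSpace ℝ (Fin n)) : x ∈ sphStar A ↔ ENNReal.ofReal (radialVol x) < volume A := by
  have hσ := ballVol_pos n
  have hσ' : ENNReal.ofReal (ballVol n) ≠ 0 := by simpa using hσ
  rw [sphStar, Metric.mem_eball, edist_zero_right, one_div,
    ENNReal.lt_rpow_inv_iff (by positivity), ENNReal.rpow_natCast,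
    ENNReal.lt_div_iff_mul_lt (Or.inl hσ') (Or.inl ENNReal.ofReal_ne_top), radialVol, mul_comm,
    ENNReal.ofReal_mul hσ.le, ENNReal.ofReal_pow (norm_nonneg _), ofReal_norm]

lemma rearr_eq_decRearr (hn : n ≠ 0) (f : EuclideanSpace ℝ (Fin n) → ℝ)
    (x : EuclideanSpace ℝ (Fin n)) : rearr f x = decRearr volume f (radialVol x) := by
  have hm := (distrib_antitone (μ := volume) f).measurable
  have hs : MeasurableSet {s : ℝ | ENNReal.ofReal (radialVol x) < distrib volume f s} :=
    measurableSet_lt (by fun_prop) (by fun_prop)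
  have h1 : (fun s : ℝ => (sphStar {y | s < |f y|}).indicator (fun _ => (1 : ENNReal)) x) =
      {s : ℝ | ENNReal.ofReal (radialVol x) < distrib volume f s}.indicator fun _ => 1 := by
    ext s
    simp only [indicator, mem_sphStar_iff hn, mem_ofPred_eq, distrib]
    congr
  rw [rearr, h1, lintegral_indicator_const hs, one_mul, Measure.restrict_apply hs, decRearr]
  congr 1; ext s; simp [and_comm]

/-- Integration in polar coordinates. -/
lemma lintegral_polar (hn : n ≠ 0) {H : EuclideanSpace ℝ (Fin n) → ENNReal} (hH : Measurable H) :
    ∫⁻ x, H x = ∫⁻ r : Ioi (0:ℝ), ∫⁻ θ : Metric.sphere (0 : EuclideanSpace ℝ (Fin n)) 1,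
      H (r.1 • θ.1) ∂(volume : Measure (EuclideanSpace ℝ (Fin n))).toSphere
        ∂(Measure.volumeIoiPow (n - 1)) := by
  have : Nonempty (Fin n) := ⟨⟨0, Nat.pos_of_ne_zero hn⟩⟩
  have hmp := (volume : Measure (EuclideanSpace ℝ (Fin n))).measurePreserving_homeomorphUnitSphereProd
  have hg : Measurable fun q : Metric.sphere (0 : EuclideanSpace ℝ (Fin n)) 1 × Ioi (0:ℝ) =>
      H (q.2.1 • q.1.1) := by
    fun_prop
  have h1 := hmp.lintegral_comp hg
  rw [finrank_euclideanSpace, Fintype.card_fin] at h1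
  rw [lintegral_prod_symm' _ hg] at h1
  have h2 : ∫⁻ x, H x = ∫⁻ x in {(0 : EuclideanSpace ℝ (Fin n))}ᶜ, H x := by
    rw [restrict_compl_singleton]
  rw [← h1, h2, ← lintegral_subtype_comap (measurableSet_singleton _).compl]
  refine lintegral_congr fun x => ?_
  congr 1
  have hx : ‖x.1‖ ≠ 0 := norm_ne_zero_iff.2 x.2
  simp [smul_smul, hx]

lemma measurable_sphAvg {v : EuclideanSpace ℝ (Fin n) → ℝ} (hv : Measurable v) :
    Measurable (sphAvg v) := by
  unfold sphAvg
  refine Measurable.lintegral_prod_right' (f := fun q : ℝ × Metric.sphere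
    (0 : EuclideanSpace ℝ (Fin n)) 1 => ENNReal.ofReal (v ((q.1 / ballVol n) ^ (1 / n : ℝ) • q.2.1))) ?_
  fun_prop

/-- On each sphere a radial factor is constant, so polar coordinates see v only through its
spherical integral. Replacing v by that integral as a radial function costs one more integration
over the sphere, hence the surface area nσ_n. -/
lemma lintegral_radial_mul_aux (hn : n ≠ 0) {v : EuclideanSpace ℝ (Fin n) → ℝ} (hv : Measurable v)
    {F : ℝ → ENNReal} (hF : Measurable F) :
    ENNReal.ofReal (n * ballVol n) * ∫⁻ x, F (radialVol x) * ENNReal.ofReal (v x) =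
      ∫⁻ s in Ioi (0:ℝ), F s * sphAvg v s := by
  have hw := measurable_sphAvg hv
  have hρ := measurable_radialVol (n := n)
  have hσ := ballVol_pos n
  rw [← lintegral_comp_radialVol hn (F := fun s => F s * sphAvg v s) (by fun_prop), lintegral_polar hn (by fun_prop),
    lintegral_polar hn (H := fun x => F (radialVol x) * sphAvg v (radialVol x)) (by fun_prop)]
  have hsph : ∀ (r : Ioi (0:ℝ)) (θ : Metric.sphere (0 : EuclideanSpace ℝ (Fin n)) 1),
      radialVol (r.1 • θ.1) = ballVol n * r.1 ^ n := by
    intro r θ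
    have h0 : 0 < r.1 := r.2
    simp [radialVol, norm_smul, abs_of_pos h0]
  simp_rw [hsph]
  rw [← lintegral_const_mul']
  · refine lintegral_congr fun r => ?_
    have h0 : 0 < r.1 := r.2
    rw [lintegral_const, Measure.toSphere_apply_univ, ← ofReal_ballVol, finrank_euclideanSpace,
      Fintype.card_fin, lintegral_const_mul, mul_comm, ENNReal.ofReal_mul (by positivity),
      ENNReal.ofReal_natCast]
    · congr 1
      simp only [sphAvg, rpow_radialVol_div hn h0.le]
    · fun_prop
  · exact ENNReal.ofReal_ne_top

/-- Spheres are null sets, so this is not automatic. The polar formula for the indicator of a null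
set N shows that almost every sphere meets N in a set of surface measure zero. -/
lemma sphAvg_congr_ae (hn : n ≠ 0) {v v' : EuclideanSpace ℝ (Fin n) → ℝ} (h : v =ᵐ[volume] v') :
    sphAvg v =ᵐ[volume.restrict (Ioi 0)] sphAvg v' := by
  obtain ⟨N, hN, hNm, hN0⟩ := exists_measurable_superset_of_null (show volume {x | ¬ v x = v' x} = 0 from h)
  have hi : Measurable (N.indicator fun _ => (1:ℝ)) := measurable_const.indicator hNm
  have h1 := lintegral_radial_mul_aux hn hi (F := fun _ => 1) measurable_const
  have h2 : ∀ᵐ x, ENNReal.ofReal (N.indicator (fun _ => (1:ℝ)) x) = 0 := by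
    filter_upwards [measure_eq_zero_iff_ae_notMem.1 hN0] with x hx
    simp [hx]
  simp only [one_mul] at h1
  rw [lintegral_congr_ae h2, lintegral_zero, mul_zero, eq_comm,
    lintegral_eq_zero_iff (measurable_sphAvg hi)] at h1
  filter_upwards [h1] with s hs
  simp only [sphAvg, Pi.zero_apply] at hs
  rw [lintegral_eq_zero_iff] at hs
  · refine lintegral_congr_ae ?_
    filter_upwards [hs] with θ hθ
    by_contra hne
    have : (s / ballVol n) ^ (1 / n : ℝ) • (θ : EuclideanSpace ℝ (Fin n)) ∈ N :=
      hN fun heq => hne (by rw [heq])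
    rw [indicator_of_mem this] at hθ
    simp at hθ
  · fun_prop

lemma aemeasurable_sphAvg (hn : n ≠ 0) {v : EuclideanSpace ℝ (Fin n) → ℝ} (hv : AEMeasurable v) :
    AEMeasurable (sphAvg v) (volume.restrict (Ioi 0)) :=
  ⟨_, measurable_sphAvg hv.measurable_mk, sphAvg_congr_ae hn hv.ae_eq_mk⟩

/-- Integrals of radial functions against `v` are integrals over the half-line against the
averaged weight. -/
lemma lintegral_radial_mul (hn : n ≠ 0) {v : EuclideanSpace ℝ (Fin n) → ℝ} (hv : AEMeasurable v)
    {F : ℝ → ENNReal} (hF : Measurable F) :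
    ∫⁻ x, F (radialVol x) * ENNReal.ofReal (v x) =
      (ENNReal.ofReal (n * ballVol n))⁻¹ * ∫⁻ s in Ioi (0:ℝ), F s * sphAvg v s := by
  have hσ := ballVol_pos n
  have hn' : (0:ℝ) < n := by positivity
  have h0 : ENNReal.ofReal (n * ballVol n) ≠ 0 := (ENNReal.ofReal_pos.2 (by positivity)).ne'
  have h1 := lintegral_radial_mul_aux hn hv.measurable_mk hF
  have h2 : ∫⁻ x, F (radialVol x) * ENNReal.ofReal (v x) =
      ∫⁻ x, F (radialVol x) * ENNReal.ofReal (hv.mk v x) :=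
    lintegral_congr_ae (hv.ae_eq_mk.mono fun x hx => by simp only [hx])
  have h3 : ∫⁻ s in Ioi (0:ℝ), F s * sphAvg v s = ∫⁻ s in Ioi (0:ℝ), F s * sphAvg (hv.mk v) s :=
    lintegral_congr_ae ((sphAvg_congr_ae hn hv.ae_eq_mk).mono fun x hx => by simp only [hx])
  rw [h2, h3, ← h1, ← mul_assoc, ENNReal.inv_mul_cancel h0 ENNReal.ofReal_ne_top, one_mul]

lemma lorentzNorm_eq (hn : n ≠ 0) {v : EuclideanSpace ℝ (Fin n) → ℝ} (hv : AEMeasurable v) (p : ℝ)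
    (f : EuclideanSpace ℝ (Fin n) → ℝ) :
    lorentzNorm p v f = ((ENNReal.ofReal (n * ballVol n))⁻¹ *
      ∫⁻ s in Ioi (0:ℝ), decRearr volume f s ^ p * sphAvg v s) ^ (1 / p) := by
  unfold lorentzNorm
  simp_rw [rearr_eq_decRearr hn]
  rw [← lintegral_radial_mul hn hv ((decRearr_measurable f).pow_const p)]

lemma measurableSet_sphStar (A : Set (EuclideanSpace ℝ (Fin n))) : MeasurableSet (sphStar A) :=
  Metric.isOpen_eball.measurableSet

lemma mass_sphStar (hn : n ≠ 0) {v : EuclideanSpace ℝ (Fin n) → ℝ} (hv : AEMeasurable v)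
    (A : Set (EuclideanSpace ℝ (Fin n))) :
    mass v (sphStar A) = (ENNReal.ofReal (n * ballVol n))⁻¹ *
      ∫⁻ s in Ioi (0:ℝ), {s | ENNReal.ofReal s < volume A}.indicator (fun _ => 1) s * sphAvg v s := by
  rw [← lintegral_radial_mul hn hv (measurable_const.indicator
    (measurableSet_lt (by fun_prop) (by fun_prop))), mass,
    ← lintegral_indicator (measurableSet_sphStar A)]
  refine lintegral_congr fun x => ?_
  simp only [indicator, mem_sphStar_iff hn, mem_ofPred_eq]
  split_ifs <;> simp

lemma mass_sphStar_of_volume_eq (hn : n ≠ 0) {v : EuclideanSpace ℝ (Fin n) → ℝ}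
    (hv : AEMeasurable v) {A : Set (EuclideanSpace ℝ (Fin n))} {t : ℝ}
    (hA : volume A = ENNReal.ofReal t) :
    mass v (sphStar A) = (ENNReal.ofReal (n * ballVol n))⁻¹ * ∫⁻ s in Ioo 0 t, sphAvg v s := by
  rw [mass_sphStar hn hv, hA]
  congr 1
  rw [← Ioi_inter_Iio, inter_comm, ← Measure.restrict_restrict measurableSet_Iio,
    ← lintegral_indicator measurableSet_Iio]
  refine setLIntegral_congr_fun measurableSet_Ioi fun s hs => ?_
  have : ENNReal.ofReal s < ENNReal.ofReal t ↔ s < t :=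
    ENNReal.ofReal_lt_ofReal_iff_of_nonneg (le_of_lt hs)
  simp only [indicator, mem_ofPred_eq, this, mem_Iio]
  split_ifs <;> simp

lemma IsWeight.aemeasurable {v : EuclideanSpace ℝ (Fin n) → ℝ} (hv : IsWeight v) :
    AEMeasurable v := hv.locallyIntegrable.aestronglyMeasurable.aemeasurable

lemma volume_preimage_radialVol (hn : n ≠ 0) (S : Set ℝ) (hS : MeasurableSet S) :
    volume (radialVol (n := n) ⁻¹' S) = volume (S ∩ Ioi 0) := by
  rw [← Measure.map_apply measurable_radialVol hS, map_radialVol hn, Measure.restrict_apply hS]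

lemma IsWeight.mass_lt_top (hn : n ≠ 0) {v : EuclideanSpace ℝ (Fin n) → ℝ} (hv : IsWeight v)
    {A : Set (EuclideanSpace ℝ (Fin n))} (hA : volume A ≠ ⊤) : mass v (sphStar A) < ⊤ := by
  have hr : (volume A / ENNReal.ofReal (ballVol n)) ^ (1 / n : ℝ) ≠ ⊤ :=
    ENNReal.rpow_ne_top_of_nonneg (by positivity)
      (ENNReal.div_ne_top hA (by simpa using ballVol_pos n))
  have hsub : sphStar A ⊆ Metric.closedBall 0
      ((volume A / ENNReal.ofReal (ballVol n)) ^ (1 / n : ℝ)).toReal := by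
    intro x hx
    rw [sphStar, Metric.mem_eball, edist_zero_right, ← ofReal_norm] at hx
    rw [mem_closedBall_zero_iff]
    exact ((ENNReal.ofReal_lt_iff_lt_toReal (norm_nonneg _) hr).1 hx).le
  have hint := hv.locallyIntegrable.integrableOn_isCompact
    (isCompact_closedBall (0 : EuclideanSpace ℝ (Fin n))
      ((volume A / ENNReal.ofReal (ballVol n)) ^ (1 / n : ℝ)).toReal)
  refine (lintegral_mono_set hsub).trans_lt ?_
  exact hint.lintegral_lt_top

lemma IsWeight.setLIntegral_sphAvg_lt_top (hn : n ≠ 0) {v : EuclideanSpace ℝ (Fin n) → ℝ}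
    (hv : IsWeight v) (t : ℝ) : ∫⁻ s in Ioo 0 t, sphAvg v s < ⊤ := by
  have hA : volume (radialVol (n := n) ⁻¹' Iio t) = ENNReal.ofReal t := by
    rw [volume_preimage_radialVol hn _ measurableSet_Iio, inter_comm, Ioi_inter_Iio, Real.volume_Ioo,
      sub_zero]
  have h1 := hv.mass_lt_top hn (hA ▸ ENNReal.ofReal_ne_top)
  rw [mass_sphStar_of_volume_eq hn hv.aemeasurable hA] at h1
  by_contra htop
  rw [not_lt, top_le_iff] at htop
  rw [htop, ENNReal.mul_top (ENNReal.inv_ne_zero.2 ENNReal.ofReal_ne_top)] at h1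
  exact lt_irrefl _ h1

end Polar

/-! ### From the triangle inequality to submodularity of A ↦ V(A*) -/

section NormToSubmodular

open Filter Topology

/-- The function of δ is the norm of a two-step function with masses K and L. As the norm is
homogeneous of degree one, its derivative at the multiple α of an indicator does not depend on α, so
both sides of the triangle inequality acquire the same factor (K+L)^(1/p-1). -/
lemma hasDerivAt_two_step {p α β γ K L : ℝ} (hp : 0 < p) (hα : 0 < α) (hKL : 0 < K + L) :
    HasDerivAt (fun δ : ℝ => ((α + β * δ) ^ p * K + (α + γ * δ) ^ p * L) ^ (1 / p))
      ((β * K + γ * L) * (K + L) ^ (1 / p - 1)) 0 := by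
  have h1 : ∀ κ : ℝ, HasDerivAt (fun δ : ℝ => (α + κ * δ) ^ p) (κ * p * α ^ (p - 1)) 0 := by
    intro κ
    have h : HasDerivAt (fun δ : ℝ => α + κ * δ) κ 0 := by
      simpa using ((hasDerivAt_id (0:ℝ)).const_mul κ).const_add α
    simpa using h.rpow_const (p := p) (Or.inl (by simpa using hα.ne'))
  have hS : α ^ p * K + α ^ p * L = α ^ p * (K + L) := by ring
  have hpos : 0 < α ^ p * (K + L) := by positivity
  have h2 := (((h1 β).mul_const K).add ((h1 γ).mul_const L)).rpow_const (p := 1 / p)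
    (Or.inl (by simpa [hS] using hpos.ne'))
  have h2' : HasDerivAt (fun δ : ℝ => ((α + β * δ) ^ p * K + (α + γ * δ) ^ p * L) ^ (1 / p))
      ((β * p * α ^ (p - 1) * K + γ * p * α ^ (p - 1) * L) * (1 / p) *
        ((α + β * 0) ^ p * K + (α + γ * 0) ^ p * L) ^ (1 / p - 1)) 0 := h2
  convert h2' using 1
  simp only [mul_zero, add_zero, hS]
  rw [Real.mul_rpow (by positivity) hKL.le, ← Real.rpow_mul hα.le]
  have h3 : α ^ (p * (1 / p - 1)) * α ^ (p - 1) = 1 := by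
    rw [← Real.rpow_add hα]
    have : p * (1 / p - 1) + (p - 1) = 0 := by field_simp; ring
    rw [this, Real.rpow_zero]
  have h4 : p * (1 / p) = 1 := by field_simp
  calc (β * K + γ * L) * (K + L) ^ (1 / p - 1)
      = (α ^ (p * (1 / p - 1)) * α ^ (p - 1)) * (p * (1 / p)) *
        ((β * K + γ * L) * (K + L) ^ (1 / p - 1)) := by rw [h3, h4]; ring
    _ = _ := by ring

/-- First-order comparison of the norms of perturbed indicator functions. -/
lemma add_le_add_of_two_step_le {p a b c d : ℝ} (hp : 0 < p) (hc : 0 < c)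
    (h : ∀ δ : ℝ, 0 < δ → ((2 + δ) ^ p * (c - d) + (2 + δ + δ) ^ p * d) ^ (1 / p) ≤
      (1 ^ p * (c - a) + (1 + δ) ^ p * a) ^ (1 / p) +
        (1 ^ p * (c - b) + (1 + δ) ^ p * b) ^ (1 / p)) :
    c + d ≤ a + b := by
  have hF := hasDerivAt_two_step (p := p) (α := 2) (β := 1) (γ := 2) (K := c - d) (L := d) hp
    two_pos (by linarith)
  have hA := hasDerivAt_two_step (p := p) (α := 1) (β := 0) (γ := 1) (K := c - a) (L := a) hp
    one_pos (by linarith)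
  have hB := hasDerivAt_two_step (p := p) (α := 1) (β := 0) (γ := 1) (K := c - b) (L := b) hp
    one_pos (by linarith)
  -- Right side minus left side vanishes at δ = 0 and is nonnegative for δ > 0, so its derivative (a
  -- + b - c - d) c^(1/p-1) at 0 is nonnegative.
  have hD := (hA.add hB).sub hF
  have hslope := hasDerivAt_iff_tendsto_slope_zero.1 hD
  have hge := ge_of_tendsto (hslope.mono_left (nhdsWithin_mono (s := Ioi (0:ℝ)) 0
    (fun x hx => ne_of_gt hx))) (b := 0) (by
    filter_upwards [self_mem_nhdsWithin] with t ht
    have ht' : 0 < t := ht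
    have h0 := h t ht'
    have hz : ((2:ℝ) ^ p * (c - d) + 2 ^ p * d) ^ (1 / p) = 2 * c ^ (1 / p) := by
      rw [← mul_add, sub_add_cancel, Real.mul_rpow (by positivity) hc.le,
        ← Real.rpow_mul (by norm_num), mul_one_div_cancel hp.ne', Real.rpow_one]
    have e1 : (2:ℝ) + 2 * t = 2 + t + t := by ring
    simp only [Pi.add_apply, Pi.sub_apply, smul_eq_mul, zero_add, zero_mul, add_zero, mul_zero,
      one_mul, hz, e1]
    refine mul_nonneg (by positivity) ?_
    simp only [Real.one_rpow, one_mul, sub_add_cancel] at h0 ⊢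
    linarith)
  have hcp : 0 < c ^ (1 / p - 1) := by positivity
  have e : (c - d + d) = c := by ring
  have e2 : (c - a + a) = c := by ring
  have e3 : (c - b + b) = c := by ring
  rw [e, e2, e3, ← add_mul, ← sub_mul] at hge
  have := nonneg_of_mul_nonneg_left hge hcp
  linarith

variable {n : ℕ}

lemma decRearr_two_step {α : Type*} [MeasurableSpace α] {μ : Measure α} {D E : Set α} (hED : E ⊆ D)
    {a b : ℝ} (ha : 0 ≤ a) (hb : 0 ≤ b) (r : ℝ) :
    decRearr μ (fun x => D.indicator (fun _ => a) x + E.indicator (fun _ => b) x) r =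
      if ENNReal.ofReal r < μ E then ENNReal.ofReal (a + b)
      else if ENNReal.ofReal r < μ D then ENNReal.ofReal a else 0 := by
  have hEDm := measure_mono (μ := μ) hED
  have habs : ∀ x, |D.indicator (fun _ => a) x + E.indicator (fun _ => b) x| =
      D.indicator (fun _ => a) x + E.indicator (fun _ => b) x := fun x =>
    abs_of_nonneg (add_nonneg (indicator_nonneg (fun _ _ => ha) x)
      (indicator_nonneg (fun _ _ => hb) x))
  have hd : ∀ s : ℝ, 0 < s → distrib μ (fun x => D.indicator (fun _ => a) x +
      E.indicator (fun _ => b) x) s = if s < a then μ D else if s < a + b then μ E else 0 := by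
    intro s hs
    simp only [distrib, habs]
    split_ifs with h1 h2
    · congr 1; ext x
      by_cases hxE : x ∈ E
      · simp [hxE, hED hxE]; linarith
      · by_cases hxD : x ∈ D
        · simp [hxE, hxD, h1]
        · simp [hxE, hxD, hs.le]
    · congr 1; ext x
      by_cases hxE : x ∈ E
      · simp [hxE, hED hxE, h2]
      · by_cases hxD : x ∈ D
        · simpa [hxE, hxD] using h1
        · simp [hxE, hxD, hs.le]
    · rw [show {y | s < D.indicator (fun _ => a) y + E.indicator (fun _ => b) y} = ∅ from ?_,
        measure_empty]
      ext x
      by_cases hxE : x ∈ E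
      · simpa [hxE, hED hxE] using h2
      · by_cases hxD : x ∈ D
        · simpa [hxE, hxD] using h1
        · simp [hxE, hxD, hs.le]
  have hset : {s : ℝ | 0 < s ∧ ENNReal.ofReal r < distrib μ (fun x => D.indicator (fun _ => a) x +
      E.indicator (fun _ => b) x) s} = if ENNReal.ofReal r < μ E then Ioo 0 (a + b)
      else if ENNReal.ofReal r < μ D then Ioo 0 a else ∅ := by
    ext s
    by_cases hs : 0 < s
    · simp only [mem_ofPred_eq, hs, true_and, hd s hs]
      by_cases hE : ENNReal.ofReal r < μ E
      · rw [if_pos hE]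
        split_ifs with h1 h2
        · simp [hE.trans_le hEDm, hs, show s < a + b by linarith]
        · simp [hE, hs, h2]
        · simp [h2]
      · rw [if_neg hE]
        by_cases hDr : ENNReal.ofReal r < μ D
        · rw [if_pos hDr]
          split_ifs with h1 h2
          · simp [hDr, hs, h1]
          · simp [hE, h1]
          · simp [h1]
        · rw [if_neg hDr]
          split_ifs with h1 h2
          · simpa using hDr
          · simpa using hE
          · simp
    · have : ¬ (s ∈ if ENNReal.ofReal r < μ E then Ioo 0 (a + b)
        else if ENNReal.ofReal r < μ D then Ioo 0 a else ∅) := by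
        split_ifs <;> simp [hs]
      simp [hs, this]
  simp only [decRearr]
  rw [hset]
  split_ifs <;> simp

lemma lorentzNorm_two_step (hn : n ≠ 0) {v : EuclideanSpace ℝ (Fin n) → ℝ} (hv : IsWeight v)
    {p : ℝ} (hp : 0 < p) {D E : Set (EuclideanSpace ℝ (Fin n))} (hED : E ⊆ D)
    (hD : volume D ≠ ⊤) {a b : ℝ} (ha : 0 ≤ a) (hb : 0 ≤ b) :
    lorentzNorm p v (fun x => D.indicator (fun _ => a) x + E.indicator (fun _ => b) x) =
      ENNReal.ofReal ((a ^ p * ((mass v (sphStar D)).toReal - (mass v (sphStar E)).toReal) +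
        (a + b) ^ p * (mass v (sphStar E)).toReal) ^ (1 / p)) := by
  have hEDm := measure_mono (μ := volume) hED
  have hsub : sphStar E ⊆ sphStar D := fun x hx =>
    (mem_sphStar_iff hn D x).2 (((mem_sphStar_iff hn E x).1 hx).trans_le hEDm)
  have hDt := (hv.mass_lt_top hn hD).ne
  have hEt := (hv.mass_lt_top hn (ne_top_of_le_ne_top hD hEDm)).ne
  have hle : mass v (sphStar E) ≤ mass v (sphStar D) := lintegral_mono_set hsub
  have hdiff : mass v (sphStar D \ sphStar E) = mass v (sphStar D) - mass v (sphStar E) := by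
    have h := lintegral_inter_add_sdiff (μ := volume) (fun x => ENNReal.ofReal (v x)) (sphStar D)
      (measurableSet_sphStar E)
    rw [inter_eq_self_of_subset_right hsub] at h
    change mass v (sphStar E) + mass v (sphStar D \ sphStar E) = mass v (sphStar D) at h
    rw [← h, ENNReal.add_sub_cancel_left hEt]
  have hle' := ENNReal.toReal_mono hDt hle
  have hap : 0 ≤ a ^ p * ((mass v (sphStar D)).toReal - (mass v (sphStar E)).toReal) :=
    mul_nonneg (by positivity) (sub_nonneg.2 hle')
  unfold lorentzNorm
  rw [← ENNReal.ofReal_rpow_of_nonneg (by positivity) (by positivity),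
    ENNReal.ofReal_add hap (by positivity), ENNReal.ofReal_mul (by positivity),
    ENNReal.ofReal_mul (by positivity), ENNReal.ofReal_toReal hEt,
    ENNReal.ofReal_sub _ ENNReal.toReal_nonneg, ENNReal.ofReal_toReal hDt,
    ENNReal.ofReal_toReal hEt, ← hdiff, ← ENNReal.ofReal_rpow_of_nonneg ha hp.le,
    ← ENNReal.ofReal_rpow_of_nonneg (add_nonneg ha hb) hp.le]
  congr 1
  unfold mass
  rw [← lintegral_const_mul' _ _ (by simp [hp.le]), ← lintegral_const_mul' _ _ (by simp [hp.le]),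
    ← lintegral_indicator ((measurableSet_sphStar D).diff (measurableSet_sphStar E)),
    ← lintegral_indicator (measurableSet_sphStar E), ← lintegral_add_left']
  · refine lintegral_congr fun x => ?_
    rw [rearr_eq_decRearr hn, decRearr_two_step hED ha hb]
    by_cases hxE : x ∈ sphStar E
    · rw [if_pos ((mem_sphStar_iff hn E x).1 hxE)]
      simp [hxE]
    · rw [if_neg fun h => hxE ((mem_sphStar_iff hn E x).2 h)]
      by_cases hxD : x ∈ sphStar D
      · rw [if_pos ((mem_sphStar_iff hn D x).1 hxD)]
        simp [hxE, hxD]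
      · rw [if_neg fun h => hxD ((mem_sphStar_iff hn D x).2 h)]
        simp [hxE, hxD, hp]
  · exact (AEMeasurable.indicator (hv.aemeasurable.ennreal_ofReal.const_mul _)
      ((measurableSet_sphStar D).diff (measurableSet_sphStar E)))

lemma submodular_of_isNormOnLorentz (hn : n ≠ 0) {v : EuclideanSpace ℝ (Fin n) → ℝ}
    (hv : IsWeight v) {p : ℝ} (hp : 1 ≤ p) (h : IsNormOnLorentz p v)
    {A B : Set (EuclideanSpace ℝ (Fin n))} (hA : NullMeasurableSet A volume)
    (hB : NullMeasurableSet B volume) :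
    mass v (sphStar (A ∪ B)) + mass v (sphStar (A ∩ B)) ≤
      mass v (sphStar A) + mass v (sphStar B) := by
  have hp0 : 0 < p := by linarith
  have hmono : ∀ {S T : Set (EuclideanSpace ℝ (Fin n))}, volume S ≤ volume T →
      mass v (sphStar S) ≤ mass v (sphStar T) := fun hST =>
    lintegral_mono_set fun x hx =>
      (mem_sphStar_iff hn _ x).2 (((mem_sphStar_iff hn _ x).1 hx).trans_le hST)
  by_cases hAt : volume A = ⊤
  · exact add_le_add (hmono (hAt ▸ le_top)) (hmono (measure_mono inter_subset_right))
  by_cases hBt : volume B = ⊤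
  · rw [add_comm (mass v (sphStar A))]
    exact add_le_add (hmono (hBt ▸ le_top)) (hmono (measure_mono inter_subset_left))
  have hCt : volume (A ∪ B) ≠ ⊤ :=
    ((measure_union_le _ _).trans_lt (ENNReal.add_lt_top.2 ⟨Ne.lt_top hAt, Ne.lt_top hBt⟩)).ne
  have hCm := (hv.mass_lt_top hn hCt).ne
  have hfin : ∀ {S : Set (EuclideanSpace ℝ (Fin n))}, S ⊆ A ∪ B → mass v (sphStar S) ≠ ⊤ :=
    fun hS => ne_top_of_le_ne_top hCm (hmono (measure_mono hS))
  have hD : A ∩ B ⊆ A ∪ B := inter_subset_left.trans subset_union_left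
  by_cases hC0 : mass v (sphStar (A ∪ B)) = 0
  · have : mass v (sphStar (A ∩ B)) = 0 :=
      le_antisymm ((hmono (measure_mono hD)).trans hC0.le) zero_le
    simp [hC0, this]
  have hae : ∀ {S : Set (EuclideanSpace ℝ (Fin n))} (c : ℝ), NullMeasurableSet S volume →
      AEMeasurable (S.indicator fun _ => c) volume := fun c hS =>
    aemeasurable_const.indicator₀ hS
  rw [← ENNReal.ofReal_toReal hCm, ← ENNReal.ofReal_toReal (hfin hD),
    ← ENNReal.ofReal_toReal (hfin (subset_union_left (s := A) (t := B))),
    ← ENNReal.ofReal_toReal (hfin (subset_union_right (s := A) (t := B))),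
    ← ENNReal.ofReal_add ENNReal.toReal_nonneg ENNReal.toReal_nonneg,
    ← ENNReal.ofReal_add ENNReal.toReal_nonneg ENNReal.toReal_nonneg]
  refine ENNReal.ofReal_le_ofReal (add_le_add_of_two_step_le hp0 (ENNReal.toReal_pos hC0 hCm) ?_)
  intro δ hδ
  have hf := lorentzNorm_two_step hn hv hp0 (subset_union_left (s := A) (t := B)) hCt
    zero_le_one hδ.le
  have hg := lorentzNorm_two_step hn hv hp0 (subset_union_right (s := A) (t := B)) hCt
    zero_le_one hδ.le
  have hs := lorentzNorm_two_step hn hv hp0 hD hCt (add_nonneg zero_le_two hδ.le) hδ.le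
  have hadd := h.add_le
    (fun x => (A ∪ B).indicator (fun _ => (1:ℝ)) x + A.indicator (fun _ => δ) x)
    ⟨(hae 1 (hA.union hB)).add (hae δ hA), hf ▸ ENNReal.ofReal_lt_top⟩
    (fun x => (A ∪ B).indicator (fun _ => (1:ℝ)) x + B.indicator (fun _ => δ) x)
    ⟨(hae 1 (hA.union hB)).add (hae δ hB), hg ▸ ENNReal.ofReal_lt_top⟩
  -- This is χ_A + χ_B = χ_{A∪B} + χ_{A∩B}, multiplied by δ.
  have hsum : ((fun x => (A ∪ B).indicator (fun _ => (1:ℝ)) x + A.indicator (fun _ => δ) x) +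
      fun x => (A ∪ B).indicator (fun _ => (1:ℝ)) x + B.indicator (fun _ => δ) x) =
      fun x => (A ∪ B).indicator (fun _ => 2 + δ) x + (A ∩ B).indicator (fun _ => δ) x := by
    ext x
    by_cases hxA : x ∈ A <;> by_cases hxB : x ∈ B <;> simp [hxA, hxB] <;> ring
  have hnn : ∀ {S : Set (EuclideanSpace ℝ (Fin n))}, S ⊆ A ∪ B →
      0 ≤ (mass v (sphStar (A ∪ B))).toReal - (mass v (sphStar S)).toReal := fun hS =>
    sub_nonneg.2 (ENNReal.toReal_mono hCm (hmono (measure_mono hS)))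
  have nA := hnn (subset_union_left (s := A) (t := B))
  have nB := hnn (subset_union_right (s := A) (t := B))
  rw [hsum, hs, hf, hg, ← ENNReal.ofReal_add (by positivity) (by positivity)] at hadd
  exact (ENNReal.ofReal_le_ofReal_iff (by positivity)).1 hadd

end NormToSubmodular

/-! ### From submodularity to monotonicity of the averaged weight -/

section SubmodularToDecreasing

open Filter Topology

variable {n : ℕ}

lemma setLIntegral_sphAvg_add_le (hn : n ≠ 0) {v : EuclideanSpace ℝ (Fin n) → ℝ} (hv : IsWeight v)
    (h : ∀ A B : Set (EuclideanSpace ℝ (Fin n)),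
      NullMeasurableSet A volume → NullMeasurableSet B volume →
      mass v (sphStar (A ∪ B)) + mass v (sphStar (A ∩ B)) ≤ mass v (sphStar A) + mass v (sphStar B))
    {a b t : ℝ} (ha : 0 < a) (hab : a ≤ b) (ht : 0 < t) :
    (∫⁻ s in Ioo 0 (b + t), sphAvg v s) + ∫⁻ s in Ioo 0 a, sphAvg v s ≤
      (∫⁻ s in Ioo 0 (a + t), sphAvg v s) + ∫⁻ s in Ioo 0 b, sphAvg v s := by
  set P : Set ℝ → Set (EuclideanSpace ℝ (Fin n)) := fun S => radialVol ⁻¹' S with hP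
  have hvol : ∀ (c d e : ℝ), 0 < c → c ≤ d → d ≤ e →
      volume (P (Ioo 0 c ∪ Ico d e)) = ENNReal.ofReal (c + e - d) := by
    intro c d e hc hcd hde
    have hdisj : Disjoint (Ioo 0 c) (Ioo d e) := by
      rw [Set.disjoint_left]; intro x hx hx'; linarith [hx.2, hx'.1]
    rw [volume_preimage_radialVol hn _ (measurableSet_Ioo.union measurableSet_Ico),
      inter_eq_self_of_subset_left (union_subset Ioo_subset_Ioi_self
        (Ico_subset_Ici_self.trans (Ici_subset_Ioi.2 (hc.trans_le hcd)))),
      measure_congr ((ae_eq_refl (Ioo 0 c)).union (Ioo_ae_eq_Ico (a := d) (b := e)).symm),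
      measure_union hdisj measurableSet_Ioo, Real.volume_Ioo, Real.volume_Ioo,
      ← ENNReal.ofReal_add (by linarith) (by linarith)]
    congr 1; ring
  have hm := measurable_radialVol (n := n)
  -- A ball of volume a together with a shell of volume t outside the ball of volume b: union and
  -- intersection with that larger ball are, up to the origin, balls of volumes b + t and a. The
  -- empty intervals `Ico b b` and `Ico a a` let one volume formula cover all four sets.
  have key := h (P (Ioo 0 a ∪ Ico b (b + t))) (P (Ioo 0 b ∪ Ico b b))
    (hm (measurableSet_Ioo.union measurableSet_Ico)).nullMeasurableSet
    (hm (measurableSet_Ioo.union measurableSet_Ico)).nullMeasurableSet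
  have e1 : P (Ioo 0 a ∪ Ico b (b + t)) ∪ P (Ioo 0 b ∪ Ico b b) = P (Ioo 0 b ∪ Ico b (b + t)) := by
    simp only [hP, ← preimage_union]
    congr 1; ext x
    simp only [mem_union, mem_Ioo, mem_Ico]
    constructor
    · rintro ((⟨h1, h2⟩ | h1) | (h1 | h1))
      · left; exact ⟨h1, by linarith⟩
      · right; exact h1
      · left; exact h1
      · linarith [h1.1, h1.2]
    · rintro (h1 | h1)
      · right; left; exact h1
      · left; right; exact h1
  have e2 : P (Ioo 0 a ∪ Ico b (b + t)) ∩ P (Ioo 0 b ∪ Ico b b) = P (Ioo 0 a ∪ Ico a a) := by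
    simp only [hP, ← preimage_inter]
    congr 1; ext x
    simp only [mem_union, mem_inter_iff, mem_Ioo, mem_Ico]
    constructor
    · rintro ⟨h1 | h1, h2 | h2⟩
      · left; exact h1
      · left; exact h1
      · linarith [h1.1, h2.2]
      · linarith [h2.1, h2.2]
    · rintro (h1 | h1)
      · exact ⟨Or.inl h1, Or.inl ⟨h1.1, by linarith⟩⟩
      · linarith [h1.1, h1.2]
  have hvm := hv.aemeasurable
  rw [e1, e2, mass_sphStar_of_volume_eq hn hvm (hvol b b (b + t) (by linarith) le_rfl (by linarith)),
    mass_sphStar_of_volume_eq hn hvm (hvol a a a ha le_rfl le_rfl),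
    mass_sphStar_of_volume_eq hn hvm (hvol a b (b + t) ha hab (by linarith)),
    mass_sphStar_of_volume_eq hn hvm (hvol b b b (by linarith) le_rfl le_rfl),
    ← mul_add, ← mul_add, ENNReal.mul_le_mul_iff_right] at key
  · convert key using 5 <;> ring
  · exact ENNReal.inv_ne_zero.2 ENNReal.ofReal_ne_top
  · have := ballVol_pos n
    exact ENNReal.inv_ne_top.2 (ENNReal.ofReal_pos.2 (by positivity)).ne'

/-- A density whose primitive is concave is almost everywhere nonincreasing. -/
lemma isDecreasingAE_of_setLIntegral {w : ℝ → ENNReal}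
    (hw : AEMeasurable w (volume.restrict (Ioi 0)))
    (hfin : ∀ t : ℝ, ∫⁻ s in Ioo 0 t, w s < ⊤)
    (h : ∀ a b t : ℝ, 0 < a → a ≤ b → 0 < t →
      (∫⁻ s in Ioo 0 (b + t), w s) + ∫⁻ s in Ioo 0 a, w s ≤
      (∫⁻ s in Ioo 0 (a + t), w s) + ∫⁻ s in Ioo 0 b, w s) :
    IsDecreasingAE w := by
  set J : ℝ → ℝ := fun t => (∫⁻ s in Ioo 0 t, w s).toReal with hJ
  have hJle : ∀ a b t : ℝ, 0 < a → a ≤ b → 0 < t → J (b + t) - J b ≤ J (a + t) - J a := by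
    intro a b t ha hab ht
    have := ENNReal.toReal_mono (ENNReal.add_lt_top.2 ⟨hfin _, hfin _⟩).ne (h a b t ha hab ht)
    rw [ENNReal.toReal_add (hfin _).ne (hfin _).ne, ENNReal.toReal_add (hfin _).ne (hfin _).ne]
      at this
    simp only [hJ]; linarith
  have hwm : ∀ t : ℝ, AEMeasurable w (volume.restrict (Ioo 0 t)) := fun t =>
    hw.mono_measure (Measure.restrict_mono (fun x hx => hx.1) le_rfl)
  have hJint : ∀ t : ℝ, 0 ≤ t → ∫ s in (0:ℝ)..t, (w s).toReal = J t := by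
    intro t ht
    rw [intervalIntegral.integral_of_le ht, integral_Ioc_eq_integral_Ioo,
      integral_toReal (hwm t) (ae_lt_top' (hwm t) (hfin t).ne)]
  have hloc : ∀ k : ℕ, IntervalIntegrable (fun s => (w s).toReal) volume 0 k := by
    intro k
    rw [intervalIntegrable_iff_integrableOn_Ioo_of_le (by positivity)]
    exact integrable_toReal_of_lintegral_ne_top (hwm k) (hfin k).ne
  have hderiv : ∀ᵐ s ∂volume.restrict (Ioi (0:ℝ)), w s < ⊤ ∧ HasDerivAt J (w s).toReal s := by
    have h1 : ∀ᵐ s : ℝ, ∀ k : ℕ, s ∈ Ioo (0:ℝ) k → w s < ⊤ := by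
      rw [ae_all_iff]; intro k
      rw [← ae_restrict_iff' measurableSet_Ioo]
      exact ae_lt_top' (hwm k) (hfin k).ne
    have h2 := ae_all_iff.2 fun k : ℕ => (hloc k).ae_hasDerivAt_integral
    rw [ae_restrict_iff' measurableSet_Ioi]
    filter_upwards [h1, h2] with s hs1 hs2 hs
    obtain ⟨k, hk⟩ := exists_nat_gt s
    have hs0 : (0:ℝ) < s := hs
    refine ⟨hs1 k ⟨hs, hk⟩, ?_⟩
    have hd := hs2 k (by rw [uIcc_of_le (by positivity)]; exact ⟨hs0.le, hk.le⟩) 0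
      (by rw [uIcc_of_le (by positivity)]; exact ⟨le_rfl, by positivity⟩)
    refine hd.congr_of_eventuallyEq ?_
    filter_upwards [Ioi_mem_nhds hs0] with t ht
    exact (hJint t (le_of_lt ht)).symm
  -- The derivative of J exists only almost everywhere. The lower limit of right difference
  -- quotients is defined everywhere, is nonincreasing because the quotients are, and equals the
  -- derivative where that exists.
  refine ⟨fun s => liminf (fun t : ℝ => ENNReal.ofReal (t⁻¹ • (J (s + t) - J s))) (𝓝[>] 0), ?_, ?_⟩
  · intro a ha b _ hab
    refine liminf_le_liminf ?_
    filter_upwards [self_mem_nhdsWithin] with t ht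
    have ht' : 0 < t := ht
    exact ENNReal.ofReal_le_ofReal (smul_le_smul_of_nonneg_left (hJle a b t ha hab ht)
      (by positivity))
  · filter_upwards [hderiv] with s hs
    have h1 := (hasDerivAt_iff_tendsto_slope_zero.1 hs.2).mono_left
      (nhdsWithin_mono (s := Ioi (0:ℝ)) 0 fun x hx => ne_of_gt hx)
    have h2 := (ENNReal.continuous_ofReal.tendsto _).comp h1
    rw [ENNReal.ofReal_toReal hs.1.ne] at h2
    exact h2.liminf_eq.symm

end SubmodularToDecreasing

/-! ### From a decreasing averaged weight to the norm -/

section DecreasingToNorm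

variable {n : ℕ}

lemma IsDecreasingAE.exists_antitone {w : ℝ → ENNReal} (hw : IsDecreasingAE w) :
    ∃ u : ℝ → ENNReal, Antitone u ∧ w =ᵐ[volume.restrict (Ioi 0)] u := by
  obtain ⟨u, hu, hwu⟩ := hw
  refine ⟨fun s => if 0 < s then u s else ⊤, ?_, ?_⟩
  · intro a b hab
    simp only
    split_ifs with h1 h2 h3
    · exact hu h2 h1 hab
    · exact le_top
    · exact absurd (h3.trans_le hab) h1
    · exact le_rfl
  · filter_upwards [hwu, ae_restrict_mem measurableSet_Ioi] with s hs hs0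
    rw [if_pos (show 0 < s from hs0), hs]

lemma ofReal_le_decRearr {α : Type*} [MeasurableSpace α] {μ : Measure α} {f : α → ℝ} {r s : ℝ}
    (h : ENNReal.ofReal r < distrib μ f s) : ENNReal.ofReal s ≤ decRearr μ f r := by
  calc ENNReal.ofReal s = volume (Ioc 0 s) := by simp
    _ ≤ volume {t : ℝ | 0 < t ∧ ENNReal.ofReal r < distrib μ f t} :=
      measure_mono fun t ht => ⟨ht.1, h.trans_le (distrib_antitone f ht.2)⟩

/-- If |f| > ε on a set A of positive measure, then f*_Sp ≥ ε on A*, so a vanishing norm forces v =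
0 almost everywhere on A*, against V(A*) > 0. -/
lemma lorentzNorm_eq_zero_iff (hn : n ≠ 0) {v : EuclideanSpace ℝ (Fin n) → ℝ} (hv : IsWeight v)
    {p : ℝ} (hp : 0 < p) {f : EuclideanSpace ℝ (Fin n) → ℝ} (hf : AEMeasurable f) :
    lorentzNorm p v f = 0 ↔ f =ᵐ[volume] 0 := by
  constructor
  · intro h
    by_contra hne
    have hpos : ∃ k : ℕ, 0 < volume {x | 1 / ((k:ℝ) + 1) < |f x|} := by
      by_contra! hall
      apply hne
      have h0 : ∀ᵐ x, ∀ k : ℕ, ¬ (1 / ((k:ℝ) + 1) < |f x|) := by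
        rw [ae_all_iff]; intro k
        simpa [ae_iff] using hall k
      filter_upwards [h0] with x hx
      by_contra hfx
      obtain ⟨k, hk⟩ := exists_nat_one_div_lt (abs_pos.2 hfx)
      exact hx k hk
    obtain ⟨k, hk⟩ := hpos
    set A := {x | 1 / ((k:ℝ) + 1) < |f x|} with hAdef
    have hA : NullMeasurableSet A volume :=
      nullMeasurableSet_lt aemeasurable_const (by fun_prop)
    have hm := hv.mass_star_pos A hA hk
    unfold lorentzNorm at h
    have hrm : Measurable (rearr f) := by
      have : rearr f = fun x => decRearr volume f (radialVol x) :=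
        funext fun x => rearr_eq_decRearr hn f x
      rw [this]; exact (decRearr_measurable f).comp measurable_radialVol
    rw [ENNReal.rpow_eq_zero_iff_of_pos (by positivity)] at h
    replace h := (lintegral_eq_zero_iff' ((hrm.pow_const p).aemeasurable.mul hv.aemeasurable.ennreal_ofReal)).1 h
    refine hm.ne' ?_
    unfold mass
    rw [lintegral_eq_zero_iff' hv.aemeasurable.ennreal_ofReal.restrict]
    filter_upwards [ae_restrict_of_ae h, ae_restrict_mem (measurableSet_sphStar A)] with x hx hxA
    have h1 : ENNReal.ofReal (1 / ((k:ℝ) + 1)) ≤ rearr f x := by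
      rw [rearr_eq_decRearr hn]
      exact ofReal_le_decRearr ((mem_sphStar_iff hn A x).1 hxA)
    have h2 : rearr f x ≠ 0 := by
      have : 0 < ENNReal.ofReal (1 / ((k:ℝ) + 1)) := ENNReal.ofReal_pos.2 (by positivity)
      exact (this.trans_le h1).ne'
    rcases mul_eq_zero.1 hx with h3 | h3
    · exact absurd ((ENNReal.rpow_eq_zero_iff_of_pos hp).1 h3) h2
    · exact h3
  · intro h
    have h1 : decRearr volume f = fun _ => 0 := by
      rw [decRearr_congr (g := (0:ℝ) • f) (h.mono fun x hx => by simp [hx])]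
      ext r; rw [decRearr_smul]; simp
    simp [lorentzNorm_eq hn hv.aemeasurable, h1, hp]

lemma isNormOnLorentz_of_isDecreasingAE (hn : n ≠ 0) {v : EuclideanSpace ℝ (Fin n) → ℝ}
    (hv : IsWeight v) {p : ℝ} (hp : 1 ≤ p) (h : IsDecreasingAE (sphAvg v)) :
    IsNormOnLorentz p v := by
  have hp0 : 0 < p := by linarith
  obtain ⟨u, hu, hvu⟩ := h.exists_antitone
  have hnorm : ∀ f : EuclideanSpace ℝ (Fin n) → ℝ, lorentzNorm p v f =
      (ENNReal.ofReal (n * ballVol n))⁻¹ ^ (1 / p) *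
        (∫⁻ s in Ioi (0:ℝ), decRearr volume f s ^ p * u s) ^ (1 / p) := by
    intro f
    rw [lorentzNorm_eq hn hv.aemeasurable, ENNReal.mul_rpow_of_nonneg _ _ (by positivity)]
    congr 2
    exact lintegral_congr_ae (hvu.mono fun s hs => by simp only [hs])
  refine ⟨fun f hf => lorentzNorm_eq_zero_iff hn hv hp0 hf.1, fun c f hf => ?_,
    fun f hf g hg => ?_⟩
  · rw [hnorm, hnorm]
    simp_rw [decRearr_smul, ENNReal.mul_rpow_of_nonneg _ _ hp0.le, mul_assoc]
    rw [lintegral_const_mul' _ _ (by simp [hp0.le]), ENNReal.mul_rpow_of_nonneg _ _ (by positivity),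
      ← ENNReal.rpow_mul, mul_one_div_cancel hp0.ne', ENNReal.rpow_one, mul_left_comm]
  · rw [hnorm, hnorm, hnorm, ← mul_add]
    gcongr
    have h1 := lintegral_rpow_le_of_antitone (u := u) hp (decRearr_antitone (μ := volume) (f + g))
      ((decRearr_measurable (μ := volume) f).add (decRearr_measurable (μ := volume) g)) hu
      (fun t _ => by
        rw [← lintegral_congr_ae (ae_restrict_of_ae_restrict_of_subset
          (fun x hx => hx.1) hvu)]
        exact hv.setLIntegral_sphAvg_lt_top hn t)
      (fun t ht => setLIntegral_decRearr_add_le hf.1 hg.1 ht)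
    refine h1.trans ?_
    have hum := hu.measurable
    have hwd : ∀ F : ℝ → ENNReal, Measurable F → ∫⁻ r in Ioi (0:ℝ), F r * u r =
        ∫⁻ r, F r ∂(volume.restrict (Ioi 0)).withDensity u := by
      intro F hF
      rw [lintegral_withDensity_eq_lintegral_mul _ hum hF]
      simp [mul_comm]
    have hfm := decRearr_measurable (μ := volume) f
    have hgm := decRearr_measurable (μ := volume) g
    rw [hwd _ (by fun_prop), hwd _ (by fun_prop), hwd _ (by fun_prop)]
    exact ENNReal.lintegral_Lp_add_le hfm.aemeasurable hgm.aemeasurable hp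

end DecreasingToNorm

/-! ### A measure-preserving map onto the half-line ordered by decreasing values of f -/

section Rank

open Filter Topology

variable {n : ℕ}

/-- The volume is 1-Lipschitz in r, since `radialVol` transports Lebesgue measure to Lebesgue
measure, so the intermediate value theorem applies. This is what lets level sets of positive measure
be split by the norm. -/
lemma exists_volume_inter_radialVol_eq (hn : n ≠ 0) {A : Set (EuclideanSpace ℝ (Fin n))}
    {τ : ℝ} (hτ : 0 ≤ τ) (h : ENNReal.ofReal τ < volume A) :
    ∃ r : ℝ, volume (A ∩ {y | radialVol y < r}) = ENNReal.ofReal τ := by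
  set G : ℝ → ENNReal := fun r => volume (A ∩ {y | radialVol y < r}) with hG
  have hGm : Monotone G := fun a b hab =>
    measure_mono (inter_subset_inter_right _ fun y hy => lt_of_lt_of_le hy hab)
  have hlt : ∀ r, volume {y : EuclideanSpace ℝ (Fin n) | radialVol y < r} = ENNReal.ofReal r := by
    intro r
    have := volume_preimage_radialVol hn (Iio r) measurableSet_Iio
    rwa [inter_comm, Ioi_inter_Iio, Real.volume_Ioo, sub_zero] at this
  have hGt : ∀ r, G r ≠ ⊤ := fun r =>
    ((measure_mono inter_subset_right).trans_lt ((hlt r).trans_lt ENNReal.ofReal_lt_top)).ne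
  have hGadd : ∀ s t, s ≤ t → G t ≤ G s + ENNReal.ofReal (t - s) := by
    intro s t hst
    have hsub : A ∩ {y | radialVol y < t} ⊆
        (A ∩ {y | radialVol y < s}) ∪ radialVol ⁻¹' Ico s t := by
      intro y hy
      rcases lt_or_ge (radialVol y) s with h1 | h1
      · exact Or.inl ⟨hy.1, h1⟩
      · exact Or.inr ⟨h1, hy.2⟩
    refine (measure_mono hsub).trans ((measure_union_le _ _).trans ?_)
    gcongr
    rw [volume_preimage_radialVol hn _ measurableSet_Ico]
    exact (measure_mono inter_subset_left).trans Real.volume_Ico.le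
  have hcont : Continuous fun r => (G r).toReal := by
    refine (LipschitzWith.of_le_add fun t s => ?_).continuous
    rcases le_total t s with hts | hst
    · exact (ENNReal.toReal_mono (hGt _) (hGm hts)).trans (le_add_of_nonneg_right dist_nonneg)
    · have := ENNReal.toReal_mono (by simp [hGt]) (hGadd s t hst)
      rwa [ENNReal.toReal_add (hGt _) ENNReal.ofReal_ne_top,
        ENNReal.toReal_ofReal (sub_nonneg.2 hst), ← abs_of_nonneg (sub_nonneg.2 hst),
        ← Real.dist_eq] at this
  have hbig : ∃ r, τ ≤ (G r).toReal := by
    by_contra! hall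
    have hU : A = ⋃ k : ℕ, A ∩ {y | radialVol y < (k:ℝ)} := by
      rw [← inter_iUnion, eq_comm, inter_eq_left]
      intro x _
      obtain ⟨k, hk⟩ := exists_nat_gt (radialVol x)
      exact mem_iUnion.2 ⟨k, hk⟩
    have hmono : Monotone fun k : ℕ => A ∩ {y | radialVol y < (k:ℝ)} := fun i j hij =>
      inter_subset_inter_right _ fun y (hy : radialVol y < (i:ℝ)) =>
        hy.trans_le (Nat.cast_le.2 hij)
    rw [hU, hmono.measure_iUnion] at h
    refine absurd h (not_lt.2 (iSup_le fun k => ?_))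
    change G k ≤ _
    rw [← ENNReal.ofReal_toReal (hGt k)]
    exact ENNReal.ofReal_le_ofReal (hall k).le
  have hsmall : ∃ r, (G r).toReal ≤ τ := by
    refine ⟨0, ?_⟩
    have : G 0 = 0 := le_antisymm ((measure_mono inter_subset_right).trans (by simp [hlt])) zero_le
    simpa [this] using hτ
  obtain ⟨r, hr⟩ := mem_range_of_exists_le_of_exists_ge hcont hsmall hbig
  exact ⟨r, by rw [← hr]; exact (ENNReal.ofReal_toReal (hGt r)).symm⟩

lemma volume_setOf_volume_inter_lt_le (hn : n ≠ 0) (A : Set (EuclideanSpace ℝ (Fin n)))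
    {τ : ℝ} (hτ : 0 ≤ τ) :
    volume {x | x ∈ A ∧ volume (A ∩ {y | radialVol y < radialVol x}) < ENNReal.ofReal τ} ≤
      ENNReal.ofReal τ := by
  rcases le_or_gt (volume A) (ENNReal.ofReal τ) with h | h
  · exact (measure_mono fun x hx => hx.1).trans h
  · obtain ⟨r, hr⟩ := exists_volume_inter_radialVol_eq hn hτ h
    rw [← hr]
    refine measure_mono fun x hx => ⟨hx.1, ?_⟩
    by_contra hle
    exact absurd hx.2 (not_lt.2 (measure_mono (inter_subset_inter_right _
      fun y (hy : radialVol y < r) => hy.trans_le (not_lt.1 hle))))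

lemma min_le_volume_setOf_volume_inter_le (hn : n ≠ 0) (A : Set (EuclideanSpace ℝ (Fin n)))
    {τ : ℝ} (hτ : 0 ≤ τ) :
    min (ENNReal.ofReal τ) (volume A) ≤
      volume {x | x ∈ A ∧ volume (A ∩ {y | radialVol y < radialVol x}) ≤ ENNReal.ofReal τ} := by
  rcases le_or_gt (volume A) (ENNReal.ofReal τ) with h | h
  · exact (min_le_right _ _).trans (measure_mono fun x hx =>
      ⟨hx, (measure_mono inter_subset_left).trans h⟩)
  · obtain ⟨r, hr⟩ := exists_volume_inter_radialVol_eq hn hτ h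
    refine (min_le_left _ _).trans ?_
    rw [← hr]
    exact measure_mono fun x hx => ⟨hx.1, measure_mono (inter_subset_inter_right _
      fun y (hy : radialVol y < radialVol x) => hy.trans hx.2)⟩

/-- The measure of the set of points that precede `x` when points are ordered by decreasing
values of `f`, ties being broken by the norm. -/
noncomputable def rank (f : EuclideanSpace ℝ (Fin n) → ℝ) (x : EuclideanSpace ℝ (Fin n)) :
    ENNReal :=
  volume {y | f x < f y ∨ (f y = f x ∧ radialVol y < radialVol x)}

lemma measurable_rank {f : EuclideanSpace ℝ (Fin n) → ℝ} (hf : Measurable f) :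
    Measurable (rank f) := by
  have hρ := measurable_radialVol (n := n)
  have hS : MeasurableSet {q : EuclideanSpace ℝ (Fin n) × EuclideanSpace ℝ (Fin n) |
      f q.1 < f q.2 ∨ (f q.2 = f q.1 ∧ radialVol q.2 < radialVol q.1)} := by
    simp only [ofPred_or, ofPred_and]
    refine MeasurableSet.union (measurableSet_lt ?_ ?_)
      (MeasurableSet.inter (measurableSet_eq_fun ?_ ?_) (measurableSet_lt ?_ ?_)) <;> fun_prop
  exact measurable_measure_prodMk_left hS

lemma rank_eq_add {f : EuclideanSpace ℝ (Fin n) → ℝ} (hf : Measurable f)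
    (x : EuclideanSpace ℝ (Fin n)) :
    rank f x = volume {y | f x < f y} +
      volume ({y | f y = f x} ∩ {y | radialVol y < radialVol x}) := by
  have hρ := measurable_radialVol (n := n)
  rw [← measure_union (by rw [Set.disjoint_left]; intro y hy hy'; exact (show f x < f y from hy).ne' hy'.1)
    ((measurableSet_eq_fun hf measurable_const).inter (measurableSet_lt hρ measurable_const))]
  rfl

lemma lt_of_rank_lt {f : EuclideanSpace ℝ (Fin n) → ℝ} {x : EuclideanSpace ℝ (Fin n)} {s : ℝ}
    (h : rank f x < volume {y | s < f y}) : s < f x := by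
  by_contra hle
  exact absurd h (not_lt.2 (measure_mono fun y hy => Or.inl (lt_of_le_of_lt (not_lt.1 hle) hy)))

lemma rank_lt_top (hn : n ≠ 0) {f : EuclideanSpace ℝ (Fin n) → ℝ} (hf : Measurable f)
    (h0 : ∀ x, 0 ≤ f x) (hfin : volume {y | 0 < f y} < ⊤) (x : EuclideanSpace ℝ (Fin n)) :
    rank f x < ⊤ := by
  rw [rank_eq_add hf]
  refine ENNReal.add_lt_top.2 ⟨(measure_mono fun y hy => ?_).trans_lt hfin,
    (measure_mono inter_subset_right).trans_lt ?_⟩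
  · exact lt_of_le_of_lt (h0 x) hy
  · have := volume_preimage_radialVol hn (Iio (radialVol x)) measurableSet_Iio
    rw [inter_comm, Ioi_inter_Iio, Real.volume_Ioo] at this
    exact this.trans_lt ENNReal.ofReal_lt_top

/-- The level is a quantile, the infimum of the l ≥ 0 with |{f > l}| ≤ t. The two bounds are
continuity of measure from below and from above. -/
lemma exists_level {f : EuclideanSpace ℝ (Fin n) → ℝ} (hn : n ≠ 0) (hf : Measurable f)
    (h0 : ∀ x, 0 ≤ f x) (hfin : volume {y | 0 < f y} < ⊤) {t : ℝ} (ht : 0 < t) :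
    ∃ l : ℝ, volume {y | l < f y} ≤ ENNReal.ofReal t ∧
      ENNReal.ofReal t ≤ volume {y | l ≤ f y} := by
  set S : Set ℝ := {l | 0 ≤ l ∧ volume {y | l < f y} ≤ ENNReal.ofReal t} with hS
  have hbd : BddBelow S := ⟨0, fun s hs => hs.1⟩
  have hmeas : ∀ l : ℝ, MeasurableSet {y | l < f y} := fun l => measurableSet_lt measurable_const hf
  have hfin' : ∀ l : ℝ, 0 ≤ l → volume {y | l < f y} ≠ ⊤ := fun l hl =>
    ((measure_mono fun y hy => lt_of_le_of_lt hl hy).trans_lt hfin).ne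
  have hSne : S.Nonempty := by
    have hanti : Antitone fun k : ℕ => {y | (k:ℝ) < f y} := fun i j hij y (hy : (j:ℝ) < f y) =>
      (Nat.cast_le.2 hij).trans_lt hy
    have h1 := hanti.measure_iInter (μ := volume) (fun k => (hmeas k).nullMeasurableSet)
      ⟨0, hfin' _ (by simp)⟩
    have h2 : ⋂ k : ℕ, {y | (k:ℝ) < f y} = ∅ := by
      refine eq_empty_of_forall_notMem fun y hy => ?_
      obtain ⟨k, hk⟩ := exists_nat_gt (f y)
      exact absurd (mem_iInter.1 hy k) (not_lt.2 hk.le)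
    rw [h2, measure_empty] at h1
    obtain ⟨k, hk⟩ := iInf_lt_iff.1 (h1 ▸ ENNReal.ofReal_pos.2 ht)
    exact ⟨k, by positivity, hk.le⟩
  have hl : 0 ≤ sInf S := le_csInf hSne fun s hs => hs.1
  refine ⟨sInf S, ?_, ?_⟩
  · have hU : {y | sInf S < f y} = ⋃ k : ℕ, {y | sInf S + 1 / ((k:ℝ) + 1) < f y} := by
      ext y
      simp only [mem_ofPred_eq, mem_iUnion]
      constructor
      · intro hy
        obtain ⟨k, hk⟩ := exists_nat_one_div_lt (sub_pos.2 hy)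
        exact ⟨k, by linarith⟩
      · rintro ⟨k, hk⟩
        have : 0 < 1 / ((k:ℝ) + 1) := by positivity
        linarith
    have hmono : Monotone fun k : ℕ => {y | sInf S + 1 / ((k:ℝ) + 1) < f y} := by
      intro i j hij y hy
      have : 1 / ((j:ℝ) + 1) ≤ 1 / ((i:ℝ) + 1) := Nat.one_div_le_one_div hij
      simp only [mem_ofPred_eq] at hy ⊢
      linarith
    rw [hU, hmono.measure_iUnion]
    refine iSup_le fun k => ?_
    obtain ⟨s, hs, hlt⟩ := exists_lt_of_csInf_lt hSne
      (show sInf S < sInf S + 1 / ((k:ℝ) + 1) from lt_add_of_pos_right _ (by positivity))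
    exact (measure_mono fun y hy => lt_trans hlt hy).trans hs.2
  · rcases hl.eq_or_lt with hl0 | hlpos
    · have : Nonempty (Fin n) := ⟨⟨0, Nat.pos_of_ne_zero hn⟩⟩
      have : {y | sInf S ≤ f y} = univ := by
        ext y; simpa [← hl0] using h0 y
      rw [this, measure_univ_of_isAddLeftInvariant]
      exact le_top
    · have hI : {y | sInf S ≤ f y} = ⋂ k : ℕ, {y | sInf S - sInf S / ((k:ℝ) + 1) < f y} := by
        ext y
        simp only [mem_ofPred_eq, mem_iInter]
        constructor
        · intro hy k
          have : 0 < sInf S / ((k:ℝ) + 1) := by positivity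
          linarith
        · intro hy
          by_contra hlt
          obtain ⟨k, hk⟩ := exists_nat_one_div_lt
            (show 0 < (sInf S - f y) / sInf S from div_pos (by linarith) hlpos)
          have h1 := hy k
          rw [lt_div_iff₀ hlpos, one_div_mul_eq_div] at hk
          linarith
      have hanti : Antitone fun k : ℕ => {y | sInf S - sInf S / ((k:ℝ) + 1) < f y} := by
        intro i j hij y hy
        have : sInf S / ((j:ℝ) + 1) ≤ sInf S / ((i:ℝ) + 1) := by gcongr
        simp only [mem_ofPred_eq] at hy ⊢
        linarith
      have hnn : ∀ k : ℕ, 0 ≤ sInf S - sInf S / ((k:ℝ) + 1) := fun k =>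
        sub_nonneg.2 (div_le_self hl (by linarith [(Nat.cast_nonneg k : (0:ℝ) ≤ k)]))
      rw [hI, hanti.measure_iInter (fun k => (hmeas _).nullMeasurableSet) ⟨0, hfin' _ (hnn 0)⟩]
      refine le_iInf fun k => ?_
      by_contra hlt
      have : 0 < sInf S / ((k:ℝ) + 1) := by positivity
      have := csInf_le hbd (show sInf S - sInf S / ((k:ℝ) + 1) ∈ S from ⟨hnn k, (not_le.1 hlt).le⟩)
      linarith

/-- Points above the quantile l all have rank at most t. The remaining volume τ = t - |{f > l}| is
taken from the level set {f = l}, ordered by the norm. -/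
lemma volume_rank_lt_le (hn : n ≠ 0) {f : EuclideanSpace ℝ (Fin n) → ℝ} (hf : Measurable f)
    (h0 : ∀ x, 0 ≤ f x) (hfin : volume {y | 0 < f y} < ⊤) {t : ℝ} (ht : 0 < t) :
    volume {x | rank f x < ENNReal.ofReal t} ≤ ENNReal.ofReal t ∧
      ENNReal.ofReal t ≤ volume {x | rank f x ≤ ENNReal.ofReal t} := by
  obtain ⟨l, hl1, hl2⟩ := exists_level hn hf h0 hfin ht
  have hlt : volume {y | l < f y} ≠ ⊤ := ne_top_of_le_ne_top ENNReal.ofReal_ne_top hl1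
  set τ : ℝ := t - (volume {y | l < f y}).toReal with hτ
  have hτ0 : 0 ≤ τ := sub_nonneg.2 (ENNReal.toReal_le_of_le_ofReal ht.le hl1)
  have hadd : volume {y | l < f y} + ENNReal.ofReal τ = ENNReal.ofReal t := by
    rw [hτ, ← ENNReal.ofReal_toReal hlt, ← ENNReal.ofReal_add ENNReal.toReal_nonneg
      (by rw [ENNReal.ofReal_toReal hlt]; exact hτ0)]
    congr 1
    rw [ENNReal.ofReal_toReal hlt]; ring
  set A := {y | f y = l} with hA
  have hAm : MeasurableSet A := measurableSet_eq_fun hf measurable_const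
  have hrank : ∀ x, f x = l → rank f x = volume {y | l < f y} +
      volume (A ∩ {y | radialVol y < radialVol x}) := by
    intro x hx
    rw [rank_eq_add hf, hx]
  constructor
  · have hsub : {x | rank f x < ENNReal.ofReal t} ⊆ {y | l < f y} ∪
        {x | x ∈ A ∧ volume (A ∩ {y | radialVol y < radialVol x}) < ENNReal.ofReal τ} := by
      intro x hx
      rcases lt_trichotomy l (f x) with h | h | h
      · exact Or.inl h
      · refine Or.inr ⟨h.symm, ?_⟩
        have hx' : rank f x < ENNReal.ofReal t := hx
        rw [hrank x h.symm, ← hadd] at hx'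
        exact lt_of_add_lt_add_left hx'
      · exact absurd hx (not_lt.2 (hl2.trans
          (measure_mono fun y hy => Or.inl (lt_of_lt_of_le h hy))))
    refine (measure_mono hsub).trans ((measure_union_le _ _).trans ?_)
    rw [← hadd]
    gcongr
    exact volume_setOf_volume_inter_lt_le hn A hτ0
  · have hsup : {y | l < f y} ∪
        {x | x ∈ A ∧ volume (A ∩ {y | radialVol y < radialVol x}) ≤ ENNReal.ofReal τ} ⊆
        {x | rank f x ≤ ENNReal.ofReal t} := by
      rintro x (hx | hx)
      · refine le_trans (measure_mono fun y hy => ?_) hl1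
        rcases hy with hy | hy
        · exact lt_trans hx hy
        · exact lt_of_lt_of_eq hx hy.1.symm
      · change rank f x ≤ _
        rw [hrank x hx.1, ← hadd]
        gcongr
        exact hx.2
    refine le_trans ?_ (measure_mono hsup)
    rw [measure_union' (by
      rw [Set.disjoint_left]; intro y hy hy'; exact (show l < f y from hy).ne' hy'.1)
      (measurableSet_lt measurable_const hf)]
    refine le_trans ?_ (add_le_add_right (min_le_volume_setOf_volume_inter_le hn A hτ0) _)
    rw [← min_add_add_left, hadd]
    refine le_min le_rfl (hl2.trans ?_)
    refine le_trans (measure_mono ?_) (measure_union_le _ _)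
    intro y hy
    rcases (show l ≤ f y from hy).lt_or_eq with h | h
    · exact Or.inl h
    · exact Or.inr h.symm

/-- The rank function transports Lebesgue measure to Lebesgue measure on the half-line. -/
lemma map_toReal_rank (hn : n ≠ 0) {f : EuclideanSpace ℝ (Fin n) → ℝ} (hf : Measurable f)
    (h0 : ∀ x, 0 ≤ f x) (hfin : volume {y | 0 < f y} < ⊤) :
    (volume : Measure (EuclideanSpace ℝ (Fin n))).map (fun x => (rank f x).toReal) =
      volume.restrict (Ioi 0) := by
  refine map_eq_restrict_Ioi (measurable_rank hf).ennreal_toReal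
    (fun x => ENNReal.toReal_nonneg) fun t ht => ?_
  have hset : {x | (rank f x).toReal < t} = {x | rank f x < ENNReal.ofReal t} := by
    ext x
    exact (ENNReal.lt_ofReal_iff_toReal_lt (rank_lt_top hn hf h0 hfin x).ne).symm
  rw [hset]
  -- The lower bound is known for non-strict sublevel sets only. Applying it at every b < t gives
  -- the strict one.
  refine le_antisymm (volume_rank_lt_le hn hf h0 hfin ht).1 (le_of_forall_lt fun a ha => ?_)
  obtain ⟨b, hab, hbt⟩ := exists_between ha
  have hb : 0 < b := (zero_le).trans_lt hab
  have hbr := ENNReal.ofReal_toReal hbt.ne_top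
  have := (volume_rank_lt_le hn hf h0 hfin (t := b.toReal)
    (ENNReal.toReal_pos hb.ne' hbt.ne_top)).2
  rw [hbr] at this
  exact hab.trans_le (this.trans (measure_mono fun x hx => lt_of_le_of_lt hx hbt))

end Rank

/-! ### Resonance: the supremum over equimeasurable functions -/

section Resonance

variable {n : ℕ}

/-- A decreasing function agrees almost everywhere with its own decreasing rearrangement. -/
lemma volume_setOf_lt_volume_ae_eq {u : ℝ → ENNReal} (hu : Antitone u) :
    ∀ᵐ r ∂volume.restrict (Ioi (0:ℝ)),
      volume {s : ℝ | 0 < s ∧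
        ENNReal.ofReal r < volume ({t | ENNReal.ofReal s < u t} ∩ Ioi 0)} = u r := by
  have hum := hu.measurable
  set m : ℝ → ENNReal := fun s => volume ({t | ENNReal.ofReal s < u t} ∩ Ioi 0) with hm
  have hmm : Measurable m := by
    have : Antitone m := fun a b hab => measure_mono (inter_subset_inter_left _
      fun t (ht : ENNReal.ofReal b < u t) => (ENNReal.ofReal_le_ofReal hab).trans_lt ht)
    exact this.measurable
  -- For fixed s, m and u are inverse to each other except possibly at the single point r = m(s).
  -- Fubini then exchanges the quantifiers, giving almost every s for almost every r.
  have hpt : ∀ s : ℝ, ∀ᵐ r ∂volume.restrict (Ioi (0:ℝ)),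
      (ENNReal.ofReal r < m s ↔ ENNReal.ofReal s < u r) := by
    intro s
    rw [ae_restrict_iff' measurableSet_Ioi]
    have hne : ∀ᵐ r : ℝ, r ≠ (m s).toReal := by
      simp [ae_iff]
    filter_upwards [hne] with r hr hr0
    have hr0' : 0 < r := hr0
    constructor
    · intro h
      by_contra hlt
      refine absurd h (not_lt.2 ?_)
      calc m s ≤ volume (Ioc 0 r) := by
            refine measure_mono fun t ht => ⟨ht.2, ?_⟩
            by_contra hrt
            exact hlt (lt_of_lt_of_le ht.1 (hu (not_le.1 hrt).le))
        _ = ENNReal.ofReal r := by simp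
    · intro h
      have hle : ENNReal.ofReal r ≤ m s := by
        calc ENNReal.ofReal r = volume (Ioc 0 r) := by simp
          _ ≤ m s := measure_mono fun t ht => ⟨lt_of_lt_of_le h (hu ht.2), ht.1⟩
      refine lt_of_le_of_ne hle fun heq => hr ?_
      rw [← heq, ENNReal.toReal_ofReal hr0'.le]
  have hcomm := (Measure.ae_ae_comm (μ := volume) (ν := volume.restrict (Ioi (0:ℝ)))
    (p := fun s r => ENNReal.ofReal r < m s ↔ ENNReal.ofReal s < u r) (by
      have h1 : MeasurableSet {q : ℝ × ℝ | ENNReal.ofReal q.2 < m q.1} :=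
        measurableSet_lt (by fun_prop) (by fun_prop)
      have h2 : MeasurableSet {q : ℝ × ℝ | ENNReal.ofReal q.1 < u q.2} :=
        measurableSet_lt (by fun_prop) (by fun_prop)
      exact (h1.mem.iff h2.mem).setOf)).1 (Filter.Eventually.of_forall hpt)
  filter_upwards [hcomm] with r hr
  rw [← volume_Ioi_inter_ofReal_lt (u r)]
  refine measure_congr ?_
  filter_upwards [hr] with s hs
  exact propext (and_congr_right fun _ => hs)

lemma decRearr_eq_iSup {α : Type*} [MeasurableSpace α] {μ : Measure α} {f : α → ℝ} {B : ℕ → Set α}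
    (hB : Monotone B) (hU : ⋃ k, B k = univ) (r : ℝ) :
    decRearr μ f r = ⨆ k, decRearr μ ((B k).indicator fun x => |f x|) r := by
  have hd : ∀ s : ℝ, 0 < s → ∀ k, distrib μ ((B k).indicator fun x => |f x|) s =
      μ ({y | s < |f y|} ∩ B k) := by
    intro s hs k
    unfold distrib
    congr 1; ext y
    by_cases hy : y ∈ B k
    · simp [hy]
    · simp [hy, hs.le]
  have hmono : ∀ s : ℝ, Monotone fun k => {y | s < |f y|} ∩ B k := fun s i j hij =>
    inter_subset_inter_right _ (hB hij)
  have hsup : ∀ s : ℝ, distrib μ f s = ⨆ k, μ ({y | s < |f y|} ∩ B k) := by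
    intro s
    rw [← (hmono s).measure_iUnion, ← inter_iUnion, hU, inter_univ]
    rfl
  have hset : {s : ℝ | 0 < s ∧ ENNReal.ofReal r < distrib μ f s} =
      ⋃ k, {s : ℝ | 0 < s ∧ ENNReal.ofReal r < distrib μ ((B k).indicator fun x => |f x|) s} := by
    ext s
    simp only [mem_ofPred_eq, mem_iUnion, exists_and_left]
    refine and_congr_right fun hs => ?_
    rw [hsup, lt_iSup_iff]
    simp_rw [hd s hs]
  simp only [decRearr]
  rw [hset, Monotone.measure_iUnion]
  rintro i j hij s ⟨hs, h⟩
  refine ⟨hs, h.trans_le ?_⟩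
  rw [hd s hs, hd s hs]
  exact measure_mono (hmono s hij)

/-- For a nonnegative function with support of finite measure, the integral of `f* u` is attained
on a function whose decreasing rearrangement is `u`. -/
lemma exists_rearrangement_of_finite_support (hn : n ≠ 0) {f : EuclideanSpace ℝ (Fin n) → ℝ}
    (hf : Measurable f) (h0 : ∀ x, 0 ≤ f x) (hfin : volume {y | 0 < f y} < ⊤)
    {u : ℝ → ENNReal} (hu : Antitone u) (hut : ∀ s, 0 < s → u s < ⊤) :
    ∃ h : EuclideanSpace ℝ (Fin n) → ℝ, Measurable h ∧
      (∀ᵐ r ∂volume.restrict (Ioi (0:ℝ)), decRearr volume h r = u r) ∧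
      ∫⁻ r in Ioi (0:ℝ), decRearr volume f r * u r ≤
        ∫⁻ x, ENNReal.ofReal (f x) * ENNReal.ofReal |h x| := by
  have hum := hu.measurable
  set T : EuclideanSpace ℝ (Fin n) → ℝ := fun x => (rank f x).toReal with hT
  have hTm : Measurable T := (measurable_rank hf).ennreal_toReal
  have hmap : volume.map T = volume.restrict (Ioi 0) := map_toReal_rank hn hf h0 hfin
  have hTpos : ∀ᵐ x, 0 < T x := by
    refine ae_of_ae_map hTm.aemeasurable (p := fun s => 0 < s) ?_
    rw [hmap]
    exact ae_restrict_mem measurableSet_Ioi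
  have hh : ∀ᵐ x, ENNReal.ofReal |(u (T x)).toReal| = u (T x) := by
    filter_upwards [hTpos] with x hx
    rw [abs_of_nonneg ENNReal.toReal_nonneg, ENNReal.ofReal_toReal (hut _ hx).ne]
  refine ⟨fun x => (u (T x)).toReal, by fun_prop, ?_, ?_⟩
  · have hd : ∀ s : ℝ, 0 < s → distrib volume (fun x => (u (T x)).toReal) s =
        volume ({t | ENNReal.ofReal s < u t} ∩ Ioi 0) := by
      intro s hs
      have hms : MeasurableSet {t | ENNReal.ofReal s < u t} :=
        measurableSet_lt measurable_const hum
      rw [← Measure.restrict_apply hms, ← hmap, Measure.map_apply hTm hms]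
      refine measure_congr ?_
      filter_upwards [hh] with x hx
      refine propext ?_
      change s < |(u (T x)).toReal| ↔ ENNReal.ofReal s < u (T x)
      rw [← hx, ENNReal.ofReal_lt_ofReal_iff_of_nonneg hs.le, hx]
    filter_upwards [volume_setOf_lt_volume_ae_eq hu] with r hr
    rw [← hr]
    simp only [decRearr]
    congr 1; ext s
    refine and_congr_right fun hs => ?_
    rw [hd s hs]
  · rw [lintegral_congr_ae (hh.mono fun x hx => by rw [hx]), lintegral_mul_eq_layercake (G := fun x => u (T x)) (by fun_prop) (by fun_prop),
      lintegral_decRearr_mul f hum]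
    refine setLIntegral_mono' measurableSet_Ioi fun s hs => ?_
    have hs0 : 0 < s := hs
    have hms : MeasurableSet {r | ENNReal.ofReal r < distrib volume f s} :=
      measurableSet_lt (by fun_prop) (by fun_prop)
    rw [← hmap, setLIntegral_map hms hum hTm]
    -- Points of rank below |{f > s}| lie in {f > s}, so each slice of ∫ f* u, transported by the
    -- rank, is at most the corresponding slice of ∫ f · u(T).
    refine lintegral_mono_set fun x hx => ?_
    change ENNReal.ofReal s < ENNReal.ofReal (f x)
    rw [ENNReal.ofReal_lt_ofReal_iff_of_nonneg hs0.le]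
    refine lt_of_rank_lt ?_
    have hx' : ENNReal.ofReal (T x) < distrib volume f s := hx
    rw [hT, ENNReal.ofReal_toReal (rank_lt_top hn hf h0 hfin x).ne] at hx'
    simpa only [distrib, abs_of_nonneg (h0 _)] using hx'

/-- Lebesgue measure is resonant: the supremum of `∫ |f h|` over all `h` equimeasurable with a
decreasing function `u` is `∫ f* u`. -/
lemma iSup_lintegral_eq_of_antitone (hn : n ≠ 0) {f : EuclideanSpace ℝ (Fin n) → ℝ}
    (hf : AEMeasurable f) {u : ℝ → ENNReal} (hu : Antitone u) (hut : ∀ s, 0 < s → u s < ⊤) :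
    (⨆ h ∈ {h : EuclideanSpace ℝ (Fin n) → ℝ | AEMeasurable h volume ∧
        rearr h =ᵐ[volume] fun x => u (radialVol x)}, ∫⁻ x, ENNReal.ofReal |f x * h x|) =
      ∫⁻ r in Ioi (0:ℝ), decRearr volume f r * u r := by
  have hum := hu.measurable
  refine le_antisymm (iSup₂_le fun h hh => ?_) ?_
  · refine (lintegral_abs_mul_le hf hh.1).trans (le_of_eq ?_)
    have hfm := decRearr_measurable (μ := volume) f
    have hhm := decRearr_measurable (μ := volume) h
    rw [← lintegral_comp_radialVol hn (F := fun s => decRearr volume f s * decRearr volume h s)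
      (by fun_prop), ← lintegral_comp_radialVol hn (F := fun s => decRearr volume f s * u s)
      (by fun_prop)]
    refine lintegral_congr_ae ?_
    filter_upwards [hh.2] with x hx
    rw [rearr_eq_decRearr hn] at hx
    simp only [hx]
  · set g := hf.mk f with hg
    have hgm : Measurable g := hf.measurable_mk
    have hfg : f =ᵐ[volume] g := hf.ae_eq_mk
    -- The rank is finite only for supports of finite measure, so |f| is cut off on balls. The h
    -- found for each cut-off competes for f itself, because |f| dominates the cut-off.
    set B : ℕ → Set (EuclideanSpace ℝ (Fin n)) := fun k => Metric.ball 0 k with hB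
    have hBm : Monotone B := fun i j hij => Metric.ball_subset_ball (Nat.cast_le.2 hij)
    have hBU : ⋃ k, B k = univ := Metric.iUnion_ball_nat 0
    have hmono : ∀ r, Monotone fun k => decRearr volume ((B k).indicator fun x => |g x|) r := by
      intro r i j hij
      refine measure_mono fun s hs => ⟨hs.1, hs.2.trans_le (measure_mono fun y hy => ?_)⟩
      refine lt_of_lt_of_le (show s < _ from hy) ?_
      rw [abs_of_nonneg (indicator_nonneg (fun _ _ => abs_nonneg _) _),
        abs_of_nonneg (indicator_nonneg (fun _ _ => abs_nonneg _) _)]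
      exact indicator_le_indicator_of_subset (hBm hij) (fun _ => abs_nonneg _) y
    rw [decRearr_congr (f := f) (g := g) (hfg.mono fun x hx => by rw [hx])]
    have hsup : ∀ r, decRearr volume g r * u r =
        ⨆ k, decRearr volume ((B k).indicator fun x => |g x|) r * u r := fun r => by
      rw [decRearr_eq_iSup hBm hBU, ENNReal.iSup_mul]
    rw [lintegral_congr hsup, lintegral_iSup
      (f := fun k r => decRearr volume ((B k).indicator fun x => |g x|) r * u r) (fun k => (decRearr_measurable _).mul hum)
      (fun i j hij r => mul_le_mul_left (hmono r hij) _)]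
    refine iSup_le fun k => ?_
    obtain ⟨h, hhm, hhu, hle⟩ := exists_rearrangement_of_finite_support hn
      (f := (B k).indicator fun x => |g x|)
      ((by fun_prop : Measurable fun x => |g x|).indicator Metric.isOpen_ball.measurableSet)
      (indicator_nonneg fun _ _ => abs_nonneg _)
      ((measure_mono fun y hy => by
        by_contra hyB
        exact absurd (show 0 < (B k).indicator (fun x => |g x|) y from hy)
          (by rw [indicator_of_notMem (show y ∉ B k from hyB)]; exact lt_irrefl 0)).trans_lt
        (measure_ball_lt_top (x := (0 : EuclideanSpace ℝ (Fin n))) (r := k))) hu hut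
    refine (hle.trans ?_).trans (le_iSup₂_of_le h ⟨hhm.aemeasurable, ?_⟩ le_rfl)
    · refine lintegral_mono_ae ?_
      filter_upwards [hfg] with x hx
      rw [abs_mul, ENNReal.ofReal_mul (abs_nonneg _), hx]
      gcongr
      exact indicator_le_self' (fun _ _ => abs_nonneg _) x
    · filter_upwards [ae_comp_radialVol hn hhu] with x hx
      rw [rearr_eq_decRearr hn, hx]

lemma lt_top_of_setLIntegral_lt_top {u : ℝ → ENNReal} (hu : Antitone u)
    (h : ∀ t : ℝ, ∫⁻ s in Ioo 0 t, u s < ⊤) {s : ℝ} (hs : 0 < s) : u s < ⊤ := by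
  by_contra htop
  rw [not_lt, top_le_iff] at htop
  refine (h s).ne (top_le_iff.1 ?_)
  calc ⊤ = ∫⁻ _ in Ioo 0 s, ⊤ := by simp [hs]
    _ ≤ _ := setLIntegral_mono' measurableSet_Ioo fun t ht => htop ▸ hu ht.2.le

lemma resonance_of_isDecreasingAE (hn : n ≠ 0) {v : EuclideanSpace ℝ (Fin n) → ℝ}
    (hv : IsWeight v) (hdec : IsDecreasingAE (sphAvg v)) {f : EuclideanSpace ℝ (Fin n) → ℝ}
    (hf : AEMeasurable f) :
    (⨆ h ∈ {h : EuclideanSpace ℝ (Fin n) → ℝ | AEMeasurable h volume ∧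
        rearr h =ᵐ[volume] fun x => sphAvg v (ballVol n * ‖x‖ ^ n)},
      ∫⁻ x, ENNReal.ofReal |f x * h x|) =
      ∫⁻ x, rearr f x * sphAvg v (ballVol n * ‖x‖ ^ n) := by
  obtain ⟨u, hu, hvu⟩ := hdec.exists_antitone
  have hae : (fun x : EuclideanSpace ℝ (Fin n) => sphAvg v (ballVol n * ‖x‖ ^ n)) =ᵐ[volume]
      fun x => u (radialVol x) :=
    ae_comp_radialVol hn hvu
  have hfin : ∀ t : ℝ, ∫⁻ s in Ioo 0 t, u s < ⊤ := by
    intro t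
    rw [← lintegral_congr_ae (ae_restrict_of_ae_restrict_of_subset (fun x hx => hx.1) hvu)]
    exact hv.setLIntegral_sphAvg_lt_top hn t
  have hset : {h : EuclideanSpace ℝ (Fin n) → ℝ | AEMeasurable h volume ∧
      rearr h =ᵐ[volume] fun x => sphAvg v (ballVol n * ‖x‖ ^ n)} =
      {h | AEMeasurable h volume ∧ rearr h =ᵐ[volume] fun x => u (radialVol x)} := by
    ext h
    exact and_congr_right fun _ => ⟨fun h1 => h1.trans hae, fun h1 => h1.trans hae.symm⟩
  rw [hset, iSup_lintegral_eq_of_antitone hn hf hu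
    (fun s hs => lt_top_of_setLIntegral_lt_top hu hfin hs)]
  have hfm := decRearr_measurable (μ := volume) f
  have hum := hu.measurable
  rw [← lintegral_comp_radialVol hn (F := fun s => decRearr volume f s * u s) (by fun_prop)]
  refine lintegral_congr_ae ?_
  filter_upwards [hae] with x hx
  rw [hx, rearr_eq_decRearr hn]

/-- A rearrangement is decreasing in |x|, so v̄ can equal one only if it is itself decreasing. The
almost everywhere identity is pulled back along `radialVol`, with a measurable representative of v̄
so that the exceptional set is measurable. -/
lemma isDecreasingAE_of_exists_rearr (hn : n ≠ 0) {v h : EuclideanSpace ℝ (Fin n) → ℝ}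
    (hv : AEMeasurable v) (hh : rearr h =ᵐ[volume] fun x => sphAvg v (ballVol n * ‖x‖ ^ n)) :
    IsDecreasingAE (sphAvg v) := by
  refine ⟨decRearr volume h, (decRearr_antitone h).antitoneOn _, ?_⟩
  obtain ⟨w, hwm, hwae⟩ := aemeasurable_sphAvg hn hv
  have hdm := decRearr_measurable (μ := volume) h
  have hmk : w =ᵐ[volume.restrict (Ioi 0)] decRearr volume h := by
    rw [← map_radialVol hn]
    refine (ae_map_iff measurable_radialVol.aemeasurable (measurableSet_eq_fun hwm hdm)).2 ?_
    filter_upwards [hh, ae_comp_radialVol hn hwae] with x h1 h2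
    rw [← h2, ← rearr_eq_decRearr hn, h1]
    rfl
  exact hwae.trans hmk

lemma isDecreasingAE_of_resonance (hn : n ≠ 0) {v : EuclideanSpace ℝ (Fin n) → ℝ}
    (hv : IsWeight v)
    (h : ∀ f : EuclideanSpace ℝ (Fin n) → ℝ, AEMeasurable f volume →
      (⨆ h ∈ {h : EuclideanSpace ℝ (Fin n) → ℝ | AEMeasurable h volume ∧
          rearr h =ᵐ[volume] fun x => sphAvg v (ballVol n * ‖x‖ ^ n)},
        ∫⁻ x, ENNReal.ofReal |f x * h x|) =
      ∫⁻ x, rearr f x * sphAvg v (ballVol n * ‖x‖ ^ n)) :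
    IsDecreasingAE (sphAvg v) := by
  by_contra hdec
  have hempty : {h : EuclideanSpace ℝ (Fin n) → ℝ | AEMeasurable h volume ∧
      rearr h =ᵐ[volume] fun x => sphAvg v (ballVol n * ‖x‖ ^ n)} = ∅ :=
    eq_empty_of_forall_notMem fun g hg =>
      hdec (isDecreasingAE_of_exists_rearr hn hv.aemeasurable hg.2)
  set A : Set (EuclideanSpace ℝ (Fin n)) := Metric.ball 0 1 with hA
  have hAm : MeasurableSet A := Metric.isOpen_ball.measurableSet
  -- For this f the right side of (d) is nσ_n V(A*), whereas the supremum over the empty set is 0.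
  have h1 := h (A.indicator fun _ => 1) ((measurable_const.indicator hAm).aemeasurable)
  rw [hempty] at h1
  simp only [mem_empty_iff_false, iSup_false, iSup_const, ENNReal.bot_eq_zero] at h1
  refine (hv.mass_star_pos A hAm.nullMeasurableSet (Metric.measure_ball_pos _ _ one_pos)).ne' ?_
  have hr : ∀ r, decRearr volume (A.indicator fun _ => (1:ℝ)) r =
      {s | ENNReal.ofReal s < volume A}.indicator (fun _ => 1) r := by
    intro r
    have := decRearr_two_step (μ := volume) (empty_subset A) zero_le_one (le_refl (0:ℝ)) r
    have e : (fun x => A.indicator (fun _ => (1:ℝ)) x +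
        (∅ : Set (EuclideanSpace ℝ (Fin n))).indicator (fun _ => (0:ℝ)) x) =
        A.indicator fun _ => 1 := by ext; simp
    rw [e] at this
    rw [this]
    simp [indicator]
  rw [mass_sphStar hn hv.aemeasurable, ← lintegral_comp_radialVol hn
    (F := fun s => {s | ENNReal.ofReal s < volume A}.indicator (fun _ => 1) s * sphAvg v s)
    ((measurable_const.indicator (measurableSet_lt (by fun_prop) (by fun_prop))).aemeasurable.mul
      (aemeasurable_sphAvg hn hv.aemeasurable))]
  simp_rw [← hr, ← rearr_eq_decRearr hn]
  rw [← mul_zero, h1]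
  rfl

end Resonance

end SphericalLorentz

/-! ### The equivalence -/

open SphericalLorentz in
theorem mainTheorem1 (n : ℕ) (hn : 2 ≤ n) (v : EuclideanSpace ℝ (Fin n) → ℝ) (hv : IsWeight v)
    (p : ℝ) (hp : 1 ≤ p) :
    List.TFAE [
      IsNormOnLorentz p v,
      ∀ A B : Set (EuclideanSpace ℝ (Fin n)),
        NullMeasurableSet A volume → NullMeasurableSet B volume →
        mass v (sphStar (A ∪ B)) + mass v (sphStar (A ∩ B)) ≤ mass v (sphStar A) + mass v (sphStar B),
      IsDecreasingAE (sphAvg v),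
      ∀ f : EuclideanSpace ℝ (Fin n) → ℝ, AEMeasurable f volume →
        (⨆ h ∈ {h : EuclideanSpace ℝ (Fin n) → ℝ | AEMeasurable h volume ∧
            rearr h =ᵐ[volume] fun x => sphAvg v (ballVol n * ‖x‖ ^ n)},
          ∫⁻ x, ENNReal.ofReal |f x * h x|) =
        ∫⁻ x, rearr f x * sphAvg v (ballVol n * ‖x‖ ^ n)] := by
  have hn0 : n ≠ 0 := by omega
  tfae_have 1 → 2 := fun h A B hA hB => submodular_of_isNormOnLorentz hn0 hv hp h hA hB
  tfae_have 2 → 3 := fun h => isDecreasingAE_of_setLIntegral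
    (aemeasurable_sphAvg hn0 hv.aemeasurable) (hv.setLIntegral_sphAvg_lt_top hn0)
    fun a b t ha hab ht => setLIntegral_sphAvg_add_le hn0 hv h ha hab ht
  tfae_have 3 → 1 := isNormOnLorentz_of_isDecreasingAE hn0 hv hp
  tfae_have 3 → 4 := fun h f hf => resonance_of_isDecreasingAE hn0 hv h hf
  tfae_have 4 → 3 := isDecreasingAE_of_resonance hn0 hv
  tfae_finish
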